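/- A $k$-counter algorithm $\mathcal A$ has as its memory a finite bit string. It starts in a (possibly random) state $M_0\in\{0,1\}^*$; each operation $\mathtt{increment}(i)$, $i\in\{1,\dots,k\}$, replaces the memory by a random bit string whose law depends only on $i$ and the current memory; and $\mathtt{query}(i)$ returns a random real number $\hat N_i$ whose law depends only on $i$ and the current memory (all these operations use independent fresh randomness). For a finite stream $w$ of increments let $N_i(w)$ be the number of occurrences of $\mathtt{increment}(i)$ in $w$, and let $|M(w)|$ be the number of bits of the memory after processing $w$. $\mathcal A$ is a $(k,\varepsilon,\delta)$-approximate counter maintaining counters with total sum at most $n$ if for every stream $w$ of at most $n$ increments and every $i$ with $N_i(w)\ge 1$, querying counter $i$ after $w$ gives $$\mathbb P\bigl(|\hat N_i-N_i(w)|\ge \varepsilon N_i(w)\bigr)\le\delta .$$ There are universal constants $c_1\in(0,1/e)$ and $c_2,c_3,c_4,c>0$ such that the following holds for all integers $k\ge1$ and $n\ge 0$ and all reals $\delta\in(0,c_1)$ and $\varepsilon\in\bigl(0,\tfrac{c_2}{\log\log(1/\delta)}\bigr)$ with $n\ge k\,c_3\log^{c_4}(1/\delta)$. Every $(k,\varepsilon,\delta)$-approximate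 counter maintaining counters with total sum at most $n$ uses $\Omega(k\log\log(1/\delta))=\Omega(k\min\{\log(n/k),\log\log(1/\delta)\})$ bits of memory in expectation; precisely, there is a stream $w$ of at most $n$ increments with $$\mathbb E|M(w)|\ \ge\ c\,k\log\log(1/\delta)\ \ge\ c\,k\min\{\log(n/k),\log\log(1/\delta)\},$$ and in this range of parameters the two bounds are of the same order: $k\min\{\log(n/k),\log\log(1/\delta)\}\ge c\,k\log\log(1/\delta)$. -/

import Mathlib

open scoped ENNReal

/-- A randomized data structure for `k` counters. Its memory is a finite bit string.
It starts in a possibly random memory state; `increment i` replaces the memory state by a new one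
that depends on the old one and on fresh random bits; `query i` returns a real number that depends
on the memory state and on fresh random bits. -/
structure CounterAlgorithm (k : ℕ) where
  init : PMF (List Bool)
  increment : Fin k → List Bool → PMF (List Bool)
  query : Fin k → List Bool → MeasureTheory.ProbabilityMeasure ℝ

namespace CounterAlgorithm

variable {k : ℕ}

/-- The law of the memory state after performing, in order, the increments listed in `w`. -/
noncomputable def law (A : CounterAlgorithm k) (w : List (Fin k)) : PMF (List Bool) :=
  w.foldl (fun p i => p.bind (A.increment i)) A.init

/-- The probability that `query i`, asked after the increments `w`, returns a value `x` with
`|x - N i| ≥ ε * N i`, where `N i = w.count i` is the current value of counter `i`. -/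
noncomputable def failureProb (A : CounterAlgorithm k) (ε : ℝ) (w : List (Fin k)) (i : Fin k) :
    ℝ≥0∞ :=
  ∑' m : List Bool, A.law w m *
    (A.query i m : MeasureTheory.Measure ℝ) {x : ℝ | ε * (w.count i : ℝ) ≤ |x - (w.count i : ℝ)|}

/-- `A` is a `(k, ε, δ)`-approximate counter on all streams of at most `n` increments.
A counter whose value is `0` is exempt: the event `|x - N i| ≥ ε * N i` is then the
whole space, and no algorithm at all could satisfy the requirement. -/
def IsApproximateCounter (A : CounterAlgorithm k) (ε δ : ℝ) (n : ℕ) : Prop :=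
  ∀ w : List (Fin k), w.length ≤ n → ∀ i : Fin k, 0 < w.count i →
    A.failureProb ε w i ≤ ENNReal.ofReal δ

/-- The expected number of bits of memory in use after the increments `w`. -/
noncomputable def expectedBits (A : CounterAlgorithm k) (w : List (Fin k)) : ℝ≥0∞ :=
  ∑' m : List Bool, A.law w m * (m.length : ℝ≥0∞)

end CounterAlgorithm

/-! The algorithm is fed a random stream arranged as a `K`-ary tree of depth `T`, where `K = 1000`
and `log (1/δ)` lies between `K ^ T` and `K ^ (T + 1)`, so that `T` has the order of `log log
(1/δ)`. At a node of level `c` each counter gets a step: a fair coin decides between `K ^ c`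
increments and none; then the `K` subtrees of level `c - 1` follow. A leaf has `T * k` coins above
it, and on average over the leaves the memory there must retain a constant amount of information per
coin. Its entropy, hence its expected length, is then of order `T * k`.

Why coins are retained (`lt_ex_windowLeaks`): fix a counter and a level `a`, which has `R = K ^ (T -
a)` nodes. The window of a node lasts from the counter's step there to the end of the subtree. If
the memory at the end of a window hardly depends on the coin, then by Bayes both coin values keep
posterior probability at least `1/4`. If at least nine tenths of the windows are like that, then,
given the memories seen, these coins are all 0 with probability at least `4 ^ (-R)`, and likewise
all 1 (`wex_le_gex`). The two cases shift the counter by about `0.8 * K ^ T` relative to each other,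
the lower levels deviate by `K ^ T / 10` only with probability `2 * exp (-10 * R)`
(`gex_deviation_le`), and the query sees the same memory. No answer suits both cases, so the failure
probability is of order `4 ^ (-R)`, more than `δ ≤ exp (-10 * R)`.

The accounting is a chain rule: strong concavity of entropy turns the leak of each coin into entropy
(`ent_coin_bind`, `info_cons`), `pathLeaks_le` adds this up along the path to a leaf,
`leafSum_pathLeaks` averages over leaves by double counting, and `ent_le_length` converts entropy to
bits. -/

namespace RandomWalk

/-! ### Expectations and total variation for discrete laws -/

variable {α β ι : Type*}

/-- The expectation of `f` under `p`. -/
noncomputable def ex (p : PMF α) (f : α → ℝ≥0∞) : ℝ≥0∞ := ∑' x, p x * f x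

theorem ex_pure (a : α) (f : α → ℝ≥0∞) : ex (PMF.pure a) f = f a := by
  classical
  unfold ex
  rw [tsum_eq_single a]
  · simp
  · intro b hb
    simp [PMF.pure_apply, hb]

theorem ex_bind (p : PMF α) (q : α → PMF β) (f : β → ℝ≥0∞) :
    ex (p.bind q) f = ex p fun x => ex (q x) f := by
  unfold ex
  simp only [PMF.bind_apply, ← ENNReal.tsum_mul_right, ← ENNReal.tsum_mul_left]
  rw [ENNReal.tsum_comm]
  simp only [mul_assoc]

theorem ex_mono (p : PMF α) {f g : α → ℝ≥0∞} (h : ∀ x, f x ≤ g x) : ex p f ≤ ex p g :=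
  ENNReal.tsum_le_tsum fun x => by gcongr; exact h x

theorem ex_add (p : PMF α) (f g : α → ℝ≥0∞) : ex p (fun x => f x + g x) = ex p f + ex p g := by
  unfold ex
  simp only [mul_add, ENNReal.tsum_add]

theorem ex_const_mul (p : PMF α) (c : ℝ≥0∞) (f : α → ℝ≥0∞) :
    ex p (fun x => c * f x) = c * ex p f := by
  unfold ex
  simp only [← ENNReal.tsum_mul_left, mul_left_comm]

theorem ex_const (p : PMF α) (c : ℝ≥0∞) : ex p (fun _ => c) = c := by
  unfold ex
  rw [ENNReal.tsum_mul_right, p.tsum_coe, one_mul]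

theorem ex_sum {σ : Type*} (p : PMF α) (s : Finset σ) (f : σ → α → ℝ≥0∞) :
    ex p (fun x => ∑ j ∈ s, f j x) = ∑ j ∈ s, ex p (f j) := by
  unfold ex
  simp only [Finset.mul_sum]
  exact Summable.tsum_finsetSum fun _ _ => ENNReal.summable

theorem ex_apply (p : PMF α) (q : α → PMF β) (y : β) : ex p (fun x => q x y) = p.bind q y := rfl

/-- A fair coin. -/
noncomputable def coin : PMF Bool := PMF.uniformOfFintype Bool

theorem ex_coin (f : Bool → ℝ≥0∞) : ex coin f = 2⁻¹ * (f true + f false) := by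
  simp [ex, coin, PMF.uniformOfFintype_apply, tsum_fintype, mul_add]

theorem coin_bind_apply (q : Bool → PMF α) (y : α) :
    coin.bind q y = 2⁻¹ * (q true y + q false y) := by
  rw [← ex_apply, ex_coin]

/-- Twice the total variation distance of `p` and `q`. -/
noncomputable def dist (p q : PMF α) : ℝ≥0∞ := ∑' y, ((p y - q y) + (q y - p y))

theorem bind_tsub_le (p q : PMF α) (f : α → PMF β) (y : β) :
    p.bind f y - q.bind f y ≤ ∑' x, (p x - q x) * f x y := by
  rw [tsub_le_iff_right, PMF.bind_apply, PMF.bind_apply, ← ENNReal.tsum_add]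
  refine ENNReal.tsum_le_tsum fun x => ?_
  rw [← add_mul]
  gcongr
  exact le_tsub_add

theorem tsum_tsub_bind_le (p q : PMF α) (f : α → PMF β) :
    ∑' y, (p.bind f y - q.bind f y) ≤ ∑' x, (p x - q x) := by
  refine (ENNReal.tsum_le_tsum (bind_tsub_le p q f)).trans ?_
  rw [ENNReal.tsum_comm]
  simp [ENNReal.tsum_mul_left, PMF.tsum_coe]

/-- Data processing: a common random map cannot separate two laws further. -/
theorem dist_bind_le (p q : PMF α) (f : α → PMF β) : dist (p.bind f) (q.bind f) ≤ dist p q := by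
  unfold dist
  rw [ENNReal.tsum_add, ENNReal.tsum_add]
  exact add_le_add (tsum_tsub_bind_le p q f) (tsum_tsub_bind_le q p f)

/-! ### Entropy: concavity, gain from a coin, bound by length -/

/-- The Shannon entropy of `p`. -/
noncomputable def ent (p : PMF α) : ℝ≥0∞ := ∑' y, ENNReal.ofReal (Real.negMulLog (p y).toReal)

/-- The tangent line at `a` to a concave function. All the entropy inequalities below come from a
choice of `a`. -/
theorem negMulLog_le_of_pos {x a : ℝ} (hx : 0 ≤ x) (ha : 0 < a) :
    Real.negMulLog x ≤ -(x * Real.log a) + a - x := by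
  rcases hx.eq_or_lt with rfl | hx
  · simp [ha.le]
  · have h := Real.log_le_sub_one_of_pos (div_pos ha hx)
    rw [Real.log_div ha.ne' hx.ne'] at h
    have h2 := mul_le_mul_of_nonneg_left h hx.le
    have h3 : x * (a / x - 1) = a - x := by field_simp
    rw [h3] at h2
    unfold Real.negMulLog
    linarith

theorem ofReal_negMulLog_add_le {x a : ℝ} (hx : 0 ≤ x) (hx1 : x ≤ 1) (ha : 0 < a) (ha1 : a ≤ 1) :
    ENNReal.ofReal (Real.negMulLog x) + ENNReal.ofReal x ≤
      ENNReal.ofReal x * ENNReal.ofReal (-Real.log a) + ENNReal.ofReal a := by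
  have hl : 0 ≤ -Real.log a := neg_nonneg.2 (Real.log_nonpos ha.le ha1)
  rw [← ENNReal.ofReal_add (Real.negMulLog_nonneg hx hx1) hx, ← ENNReal.ofReal_mul hx,
    ← ENNReal.ofReal_add (mul_nonneg hx hl) ha.le]
  apply ENNReal.ofReal_le_ofReal
  have := negMulLog_le_of_pos hx ha
  linarith

theorem toReal_mem (p : PMF α) (y : α) : 0 ≤ (p y).toReal ∧ (p y).toReal ≤ 1 :=
  ⟨ENNReal.toReal_nonneg, by simpa using ENNReal.toReal_mono ENNReal.one_ne_top (p.coe_le_one y)⟩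

theorem ofReal_toReal (p : PMF α) (y : α) : ENNReal.ofReal (p y).toReal = p y :=
  ENNReal.ofReal_toReal (p.apply_ne_top y)

/-- Concavity of entropy: at each outcome, average the tangent inequality taken at the mixture's
probability. The linear term is kept on the left to avoid subtraction in `ℝ≥0∞`. -/
theorem ex_ent_le (p : PMF α) (f : α → PMF β) : ex p (fun x => ent (f x)) ≤ ent (p.bind f) := by
  have key : ∀ y, ex p (fun x => ENNReal.ofReal (Real.negMulLog (f x y).toReal)) ≤
      ENNReal.ofReal (Real.negMulLog (p.bind f y).toReal) := by
    intro y
    by_cases h0 : p.bind f y = 0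
    · have h1 : ∀ x, p x * f x y = 0 := by
        rw [PMF.bind_apply] at h0
        exact ENNReal.tsum_eq_zero.1 h0
      have : ex p (fun x => ENNReal.ofReal (Real.negMulLog (f x y).toReal)) = 0 := by
        refine ENNReal.tsum_eq_zero.2 fun x => ?_
        rcases mul_eq_zero.1 (h1 x) with h | h <;> simp [h]
      rw [this]
      exact zero_le
    · set a := (p.bind f y).toReal with ha
      have hapos : 0 < a := ENNReal.toReal_pos h0 (PMF.apply_ne_top _ _)
      have ha1 : a ≤ 1 := (toReal_mem _ y).2
      have haE : ENNReal.ofReal a = p.bind f y := ofReal_toReal _ _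
      have h2 : ex p (fun x => ENNReal.ofReal (Real.negMulLog (f x y).toReal) + f x y) ≤
          ex p (fun x => ENNReal.ofReal (-Real.log a) * f x y + ENNReal.ofReal a) := by
        refine ex_mono p fun x => ?_
        have := ofReal_negMulLog_add_le (toReal_mem (f x) y).1 (toReal_mem (f x) y).2 hapos ha1
        rw [ofReal_toReal] at this
        rwa [mul_comm (ENNReal.ofReal (-Real.log a))]
      rw [ex_add, ex_add, ex_const, ex_const_mul, ex_apply, ← haE] at h2
      rw [ENNReal.add_le_add_iff_right ENNReal.ofReal_ne_top] at h2
      refine h2.trans_eq ?_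
      rw [← ENNReal.ofReal_mul (neg_nonneg.2 (Real.log_nonpos hapos.le ha1))]
      congr 1
      unfold Real.negMulLog
      ring
  calc ex p (fun x => ent (f x))
      = ∑' y, ex p (fun x => ENNReal.ofReal (Real.negMulLog (f x y).toReal)) := by
        unfold ex ent
        simp only [← ENNReal.tsum_mul_left]
        rw [ENNReal.tsum_comm]
    _ ≤ _ := ENNReal.tsum_le_tsum key

theorem two_mul_cosh_le {η : ℝ} (h1 : |η| ≤ 1) : 2 * Real.cosh η ≤ 2 + 2 * η ^ 2 := by
  have h := Real.cosh_le_exp_half_sq η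
  have hs : η ^ 2 ≤ 1 := by rw [← sq_abs]; nlinarith [abs_nonneg η]
  have h2 := Real.abs_exp_sub_one_le (x := η ^ 2 / 2) (by
    rw [abs_of_nonneg (by positivity)]; linarith)
  rw [abs_of_nonneg (a := η ^ 2 / 2) (by positivity)] at h2
  have := le_abs_self (Real.exp (η ^ 2 / 2) - 1)
  linarith

/-- Strong concavity of `negMulLog`, in a form that is linear in `x - y`. -/
theorem negMulLog_average {x y η : ℝ} (hx : 0 ≤ x) (hy : 0 ≤ y) (h1 : |η| ≤ 1) :
    (Real.negMulLog x + Real.negMulLog y) / 2 + η / 2 * (x - y) ≤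
      Real.negMulLog ((x + y) / 2) + η ^ 2 * ((x + y) / 2) := by
  rcases (add_nonneg hx hy).eq_or_lt with h | h
  · have hx0 : x = 0 := by linarith
    have hy0 : y = 0 := by linarith
    simp [hx0, hy0]
  · set m := (x + y) / 2 with hm
    have hm0 : 0 < m := by positivity
    -- Tilting the two tangent points to `m * exp η` and `m * exp (-η)` produces the term `η * (x -
    -- y)`; the price is `2 * cosh η - 2`, of order `η ^ 2`.
    have e1 := negMulLog_le_of_pos hx (mul_pos hm0 (Real.exp_pos η))
    have e2 := negMulLog_le_of_pos hy (mul_pos hm0 (Real.exp_pos (-η)))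
    rw [Real.log_mul hm0.ne' (Real.exp_pos _).ne', Real.log_exp] at e1 e2
    have e3 := two_mul_cosh_le h1
    rw [Real.cosh_eq] at e3
    have e4 := mul_le_mul_of_nonneg_left e3 hm0.le
    have e5 : Real.negMulLog m = -(m * Real.log m) := by unfold Real.negMulLog; ring
    have e6 : x + y = 2 * m := by rw [hm]; ring
    rw [e5]
    have e7 : (x + y) * Real.log m = 2 * m * Real.log m := by rw [e6]
    nlinarith

theorem negMulLog_average_abs {x y η : ℝ} (hx : 0 ≤ x) (hy : 0 ≤ y) (h0 : 0 ≤ η) (h1 : η ≤ 1) :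
    (Real.negMulLog x + Real.negMulLog y) / 2 + η / 2 * |x - y| ≤
      Real.negMulLog ((x + y) / 2) + η ^ 2 * ((x + y) / 2) := by
  rcases abs_cases (x - y) with ⟨h, -⟩ | ⟨h, -⟩
  · rw [h]
    exact negMulLog_average hx hy (by rwa [abs_of_nonneg h0])
  · have := negMulLog_average (η := -η) hx hy (by rwa [abs_neg, abs_of_nonneg h0])
    rw [h]
    nlinarith

theorem tsub_add_tsub_eq (p q : PMF α) (y : α) :
    (p y - q y) + (q y - p y) = ENNReal.ofReal |(p y).toReal - (q y).toReal| := by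
  rw [← ofReal_toReal p, ← ofReal_toReal q, ← ENNReal.ofReal_sub _ (toReal_mem q y).1,
    ← ENNReal.ofReal_sub _ (toReal_mem p y).1]
  simp only [ofReal_toReal]
  rcases le_total (p y).toReal (q y).toReal with h | h
  · rw [ENNReal.ofReal_of_nonpos (by linarith), zero_add, abs_of_nonpos (by linarith)]
    congr 1; ring
  · rw [ENNReal.ofReal_of_nonpos (p := (q y).toReal - _) (by linarith), add_zero,
      abs_of_nonneg (by linarith)]

/-- The mutual information between a coin and the outcome, bounded below linearly in the distance
instead of by its square as in Pinsker. Linearity lets the leaks of many coins be summed and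
averaged directly. -/
theorem ent_coin_bind {η : ℝ} (h0 : 0 ≤ η) (h1 : η ≤ 1) (q : Bool → PMF α) :
    ex coin (fun b => ent (q b)) + ENNReal.ofReal (η / 2) * dist (q true) (q false) ≤
      ent (coin.bind q) + ENNReal.ofReal (η ^ 2) := by
  have e : ENNReal.ofReal (η ^ 2) = ∑' y, ENNReal.ofReal (η ^ 2) * coin.bind q y := by
    rw [ENNReal.tsum_mul_left, PMF.tsum_coe, mul_one]
  rw [e, ex_coin]
  unfold ent dist
  rw [← ENNReal.tsum_add, ← ENNReal.tsum_mul_left, ← ENNReal.tsum_mul_left, ← ENNReal.tsum_add,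
    ← ENNReal.tsum_add]
  refine ENNReal.tsum_le_tsum fun y => ?_
  obtain ⟨a0, a1⟩ := toReal_mem (q true) y
  obtain ⟨b0, b1⟩ := toReal_mem (q false) y
  have hav : (coin.bind q y).toReal = ((q true y).toReal + (q false y).toReal) / 2 := by
    rw [coin_bind_apply, ENNReal.toReal_mul, ENNReal.toReal_add (PMF.apply_ne_top _ _)
      (PMF.apply_ne_top _ _)]
    simp; ring
  have n1 := Real.negMulLog_nonneg a0 a1
  have n2 := Real.negMulLog_nonneg b0 b1
  have e2 : coin.bind q y =
      ENNReal.ofReal (((q true y).toReal + (q false y).toReal) / 2) := by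
    rw [← hav, ofReal_toReal]
  rw [tsub_add_tsub_eq, hav, e2]
  have h2 : (2⁻¹ : ℝ≥0∞) = ENNReal.ofReal 2⁻¹ := by
    rw [ENNReal.ofReal_inv_of_pos (by norm_num)]; simp
  rw [h2, ← ENNReal.ofReal_add n1 n2, ← ENNReal.ofReal_mul (by norm_num),
    ← ENNReal.ofReal_mul (by positivity), ← ENNReal.ofReal_mul (by positivity),
    ← ENNReal.ofReal_add (by positivity) (by positivity),
    ← ENNReal.ofReal_add (Real.negMulLog_nonneg (by positivity) (by linarith)) (by positivity)]
  apply ENNReal.ofReal_le_ofReal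
  have := negMulLog_average_abs a0 b0 h0 h1
  linarith

theorem tsum_list_bool_le : ∑' y : List Bool, ENNReal.ofReal ((1 / 4 : ℝ) ^ y.length / 2) ≤ 1 := by
  rw [← (Equiv.sigmaFiberEquiv (List.length : List Bool → ℕ)).tsum_eq, ENNReal.tsum_sigma']
  have h : ∀ n : ℕ, ∑' y : {l : List Bool // l.length = n},
      ENNReal.ofReal ((1 / 4 : ℝ) ^ (y : List Bool).length / 2) = 2⁻¹ ^ (n + 1) := by
    intro n
    have h1 : ∀ y : {l : List Bool // l.length = n},
        ENNReal.ofReal ((1 / 4 : ℝ) ^ (y : List Bool).length / 2) =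
          ENNReal.ofReal ((1 / 4 : ℝ) ^ n / 2) := fun y => by rw [y.2]
    let _ : Fintype {l : List Bool // l.length = n} :=
      inferInstanceAs (Fintype (List.Vector Bool n))
    have hc : Fintype.card {l : List Bool // l.length = n} = 2 ^ n :=
      (card_vector (α := Bool) n).trans (by simp)
    simp only [h1]
    rw [tsum_fintype, Finset.sum_const, Finset.card_univ, hc, nsmul_eq_mul]
    have h2 : (2⁻¹ : ℝ≥0∞) = ENNReal.ofReal 2⁻¹ := by
      rw [ENNReal.ofReal_inv_of_pos (by norm_num)]; simp
    rw [h2, ← ENNReal.ofReal_pow (by norm_num), ← ENNReal.ofReal_natCast,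
      ← ENNReal.ofReal_mul (by positivity)]
    congr 1
    push_cast
    rw [pow_succ, mul_div_assoc', ← mul_pow]
    norm_num
    ring
  have h3 : ∑' n : ℕ, (2⁻¹ : ℝ≥0∞) ^ (n + 1) = 1 := by
    rw [ENNReal.tsum_geometric_add_one, ENNReal.one_sub_inv_two, inv_inv,
      ENNReal.inv_mul_cancel (by norm_num) (by norm_num)]
  calc _ = ∑' n : ℕ, (2⁻¹ : ℝ≥0∞) ^ (n + 1) := tsum_congr h
    _ ≤ 1 := h3.le

/-- Gibbs' inequality against the weights `4 ^ (-length) / 2`, whose total is at most 1 since there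
are `2 ^ n` strings of length `n`. -/
theorem ent_le_length (p : PMF (List Bool)) :
    ent p ≤ ENNReal.ofReal (Real.log 4) * ex p (fun y => (y.length : ℝ≥0∞)) +
      ENNReal.ofReal (Real.log 2) := by
  have key : ∀ y : List Bool, ENNReal.ofReal (Real.negMulLog (p y).toReal) + p y ≤
      p y * (ENNReal.ofReal (Real.log 4) * y.length + ENNReal.ofReal (Real.log 2)) +
        ENNReal.ofReal ((1 / 4 : ℝ) ^ y.length / 2) := by
    intro y
    have hle : (1 / 4 : ℝ) ^ y.length / 2 ≤ 1 := by
      have := pow_le_one₀ (n := y.length) (by norm_num : (0 : ℝ) ≤ 1 / 4) (by norm_num)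
      linarith
    have := ofReal_negMulLog_add_le (toReal_mem p y).1 (toReal_mem p y).2
      (a := (1 / 4 : ℝ) ^ y.length / 2) (by positivity) hle
    rw [ofReal_toReal] at this
    refine this.trans_eq ?_
    congr 2
    rw [← ENNReal.ofReal_natCast, ← ENNReal.ofReal_mul (Real.log_nonneg (by norm_num)),
      ← ENNReal.ofReal_add (mul_nonneg (Real.log_nonneg (by norm_num)) (by positivity))
        (Real.log_nonneg (by norm_num))]
    congr 1
    rw [Real.log_div (by positivity) (by norm_num), Real.log_pow, one_div, Real.log_inv]
    ring
  have h := ENNReal.tsum_le_tsum key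
  rw [ENNReal.tsum_add, ENNReal.tsum_add, PMF.tsum_coe] at h
  have h2 : ∑' y, p y * (ENNReal.ofReal (Real.log 4) * (y.length : ℝ≥0∞) +
      ENNReal.ofReal (Real.log 2)) = ENNReal.ofReal (Real.log 4) *
        ex p (fun y => (y.length : ℝ≥0∞)) + ENNReal.ofReal (Real.log 2) := by
    change ex p _ = _
    rw [ex_add, ex_const, ex_const_mul]
  rw [h2] at h
  have h4 := h.trans (add_le_add_right tsum_list_bool_le _)
  exact (ENNReal.add_le_add_iff_right ENNReal.one_ne_top).1 h4

/-! ### Coin-driven runs and the chain rule for leaks -/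

/-- The law of the state after the steps in `l`, where the step `p` applies `κ p b` with a fair
coin `b`. -/
noncomputable def run (κ : ι → Bool → α → PMF α) : List ι → α → PMF α
  | [], m => PMF.pure m
  | p :: l, m => coin.bind fun b => (κ p b m).bind (run κ l)

variable (κ : ι → Bool → α → PMF α)

theorem run_append (l l' : List ι) (m : α) :
    run κ (l ++ l') m = (run κ l m).bind (run κ l') := by
  induction l generalizing m with
  | nil => simp [run]
  | cons p l ih =>
    simp only [List.cons_append, run, PMF.bind_bind]
    rw [funext ih]

theorem ex_run_append (l l' : List ι) (m : α) (f : α → ℝ≥0∞) :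
    ex (run κ (l ++ l') m) f = ex (run κ l m) fun x => ex (run κ l' x) f := by
  rw [run_append, ex_bind]

/-- How well the state after `p :: l` reveals the coin tossed in the step `p`. -/
noncomputable def leak (p : ι) (l : List ι) (m : α) : ℝ≥0∞ :=
  dist ((κ p true m).bind (run κ l)) ((κ p false m).bind (run κ l))

theorem leak_append_le (p : ι) (l l' : List ι) (m : α) :
    leak κ p (l ++ l') m ≤ leak κ p l m := by
  have h : run κ (l ++ l') = fun x => (run κ l x).bind (run κ l') :=
    funext fun x => run_append κ l l' x
  unfold leak
  rw [h, ← PMF.bind_bind, ← PMF.bind_bind]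
  exact dist_bind_le _ _ _

theorem info_append {l : List ι} {g : α → ℝ≥0∞} {C : ℝ≥0∞}
    (h : ∀ m, g m ≤ ent (run κ l m) + C) (l₀ : List ι) (m : α) :
    ex (run κ l₀ m) g ≤ ent (run κ (l₀ ++ l) m) + C := by
  calc ex (run κ l₀ m) g ≤ ex (run κ l₀ m) (fun x => ent (run κ l x) + C) := ex_mono _ h
    _ ≤ _ := by
      rw [ex_add, ex_const, run_append]
      gcongr
      exact ex_ent_le _ _

/-- One step of the chain rule. The final entropy is the average entropy given the first coin, which
pays for `g`, plus the information about that coin, which pays for its leak up to an error `η ^ 2`.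
-/
theorem info_cons {η : ℝ} (h0 : 0 ≤ η) (h1 : η ≤ 1) {l : List ι} {g : α → ℝ≥0∞} {C : ℝ≥0∞}
    (h : ∀ m, g m ≤ ent (run κ l m) + C) (p : ι) (m : α) :
    ENNReal.ofReal (η / 2) * leak κ p l m + ex (run κ [p] m) g ≤
      ent (run κ (p :: l) m) + (C + ENNReal.ofReal (η ^ 2)) := by
  have h3 : ex (run κ [p] m) g ≤ ex coin (fun b => ent ((κ p b m).bind (run κ l))) + C := by
    have : ex (run κ [p] m) g = ex coin fun b => ex (κ p b m) g := by
      simp only [run, ex_bind, ex_pure]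
    rw [this, ← ex_const coin C, ← ex_add]
    refine ex_mono _ fun b => (ex_mono _ h).trans ?_
    rw [ex_add, ex_const]
    gcongr
    exact ex_ent_le _ _
  have h4 := ent_coin_bind h0 h1 fun b => (κ p b m).bind (run κ l)
  calc _ ≤ ENNReal.ofReal (η / 2) * leak κ p l m +
        (ex coin (fun b => ent ((κ p b m).bind (run κ l))) + C) := by gcongr
    _ = (ex coin (fun b => ent ((κ p b m).bind (run κ l))) +
        ENNReal.ofReal (η / 2) * leak κ p l m) + C := by ring
    _ ≤ (ent (run κ (p :: l) m) + ENNReal.ofReal (η ^ 2)) + C := add_le_add_left h4 C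
    _ = _ := by ring

/-- The expected total leak of the steps of `J` in `J ++ l`. -/
noncomputable def leaks : List ι → List ι → α → ℝ≥0∞
  | [], _, _ => 0
  | p :: J, l, m => leak κ p (J ++ l) m + ex (run κ [p] m) (leaks J l)

theorem info_block {η : ℝ} (h0 : 0 ≤ η) (h1 : η ≤ 1) {l : List ι} {g : α → ℝ≥0∞} {C : ℝ≥0∞}
    (h : ∀ m, g m ≤ ent (run κ l m) + C) (J : List ι) (m : α) :
    ENNReal.ofReal (η / 2) * leaks κ J l m + ex (run κ J m) g ≤
      ent (run κ (J ++ l) m) + (C + J.length * ENNReal.ofReal (η ^ 2)) := by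
  induction J generalizing m with
  | nil => simpa [leaks, run, ex_pure] using h m
  | cons p J ih =>
    have := info_cons κ h0 h1 ih p m
    rw [ex_add, ex_const_mul, ← ex_run_append] at this
    simp only [leaks, List.cons_append, List.length_cons]
    rw [mul_add, add_assoc]
    refine this.trans_eq ?_
    push_cast
    ring

theorem leaks_append_le (J l l' : List ι) (m : α) : leaks κ J (l ++ l') m ≤ leaks κ J l m := by
  induction J generalizing m with
  | nil => simp [leaks]
  | cons p J ih =>
    simp only [leaks]
    rw [← List.append_assoc]
    exact add_le_add (leak_append_le κ p _ l' m) (ex_mono _ ih)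

theorem leaks_eq_sum (J l : List ι) (m : α) :
    leaks κ J l m = ∑ j : Fin J.length,
      ex (run κ (J.take j) m) (leak κ J[j] (J.drop (j + 1) ++ l)) := by
  induction J generalizing m with
  | nil => simp [leaks]
  | cons p J ih =>
    have : (p :: J).length = J.length + 1 := rfl
    simp only [leaks]
    rw [funext ih, ex_sum]
    change _ = ∑ j : Fin (J.length + 1), _
    rw [Fin.sum_univ_succ]
    simp [run, ex_pure, ex_bind]

end RandomWalk

/-! ### The tree schedule, its windows and its leaves -/

namespace RandomWalk

variable {α ι : Type*}

/-- The concatenation of `q` copies of `l`. -/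
def rep (q : ℕ) (l : List α) : List α := (List.replicate q l).flatten

theorem rep_add (q q' : ℕ) (l : List α) : rep (q + q') l = rep q l ++ rep q' l := by
  rw [rep, List.replicate_add, List.flatten_append]
  rfl

theorem rep_succ (q : ℕ) (l : List α) : rep (q + 1) l = l ++ rep q l := by
  simp [rep, List.replicate_succ]

section windows

variable (κ : ι → Bool → α → PMF α) (p : ι) (post : List ι)

/-- Replace each window `none` by the list `p :: post` of its steps. -/
def expand : List (Option ι) → List ι
  | [] => []
  | some q :: s => q :: expand s
  | none :: s => (p :: post) ++ expand s

theorem expand_append (s s' : List (Option ι)) :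
    expand p post (s ++ s') = expand p post s ++ expand p post s' := by
  induction s with
  | nil => rfl
  | cons o s ih => cases o <;> simp [expand, ih]

theorem expand_map_some (J : List ι) : expand p post (J.map some) = J := by
  induction J with
  | nil => rfl
  | cons q J ih => simp [expand, ih]

theorem expand_rep (q : ℕ) (s : List (Option ι)) :
    expand p post (rep q s) = rep q (expand p post s) := by
  induction q with
  | zero => rfl
  | succ q ih => rw [rep_succ, rep_succ, expand_append, ih]

/-- The expected total leak of the first steps of the windows, each seen at the end of its
window. -/
noncomputable def windowLeaks : List (Option ι) → α → ℝ≥0∞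
  | [], _ => 0
  | some q :: s, m => ex (run κ [q] m) (windowLeaks s)
  | none :: s, m => leak κ p post m + ex (run κ (p :: post) m) (windowLeaks s)

theorem windowLeaks_append (s s' : List (Option ι)) (m : α) :
    windowLeaks κ p post (s ++ s') m =
      windowLeaks κ p post s m + ex (run κ (expand p post s) m) (windowLeaks κ p post s') := by
  induction s generalizing m with
  | nil => simp [windowLeaks, expand, run, ex_pure]
  | cons o s ih =>
    cases o with
    | none =>
      simp only [List.cons_append, windowLeaks, expand]
      rw [funext ih, ex_add, ← ex_run_append, add_assoc, List.cons_append]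
    | some q =>
      simp only [List.cons_append, windowLeaks, expand]
      rw [funext ih, ex_add, ← ex_run_append]
      rfl

theorem windowLeaks_map_some_append (J : List ι) (s : List (Option ι)) (m : α) :
    windowLeaks κ p post (J.map some ++ s) m = ex (run κ J m) (windowLeaks κ p post s) := by
  induction J generalizing m with
  | nil => simp [run, ex_pure]
  | cons q J ih =>
    simp only [List.map_cons, List.cons_append, windowLeaks]
    rw [funext ih, ← ex_run_append]
    rfl

theorem windowLeaks_rep (q : ℕ) (s : List (Option ι)) (m : α) :
    windowLeaks κ p post (rep q s) m = ∑ j ∈ Finset.range q,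
      ex (run κ (rep j (expand p post s)) m) (windowLeaks κ p post s) := by
  induction q with
  | zero => rfl
  | succ q ih =>
    have h1 : rep 1 s = s := by simp [rep]
    rw [rep_add, windowLeaks_append, ih, Finset.sum_range_succ, expand_rep, h1]

end windows

section tree

variable {k : ℕ} (K : ℕ)

/-- One step for each counter, on level `c`. -/
def block (k c : ℕ) : List (ℕ × Fin k) := (List.finRange k).map fun i => (c, i)

/-- The recursive schedule of the steps: a block on the top level, then `K` copies of the schedule
with one level less. -/
def schedule (k : ℕ) : ℕ → List (ℕ × Fin k)
  | 0 => []
  | c + 1 => block k (c + 1) ++ rep K (schedule k c)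

/-- What follows the step `(c + 1, i)` in `schedule k (c + 1)`. -/
def tailSteps (c : ℕ) (i : Fin k) : List (ℕ × Fin k) :=
  (block k (c + 1)).drop (i + 1) ++ rep K (schedule K k c)

/-- The schedule with `c + 1 + d` levels, cut into windows at the steps `(c + 1, i)`. -/
def windows (c : ℕ) (i : Fin k) : ℕ → List (Option (ℕ × Fin k))
  | 0 => ((block k (c + 1)).take i).map some ++ [none]
  | d + 1 => (block k (c + 1 + d + 1)).map some ++ rep K (windows c i d)

/-- The steps up to the leaf with address `t`. -/
def leafSteps (k : ℕ) : ℕ → List ℕ → List (ℕ × Fin k)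
  | 0, _ => []
  | c + 1, t => block k (c + 1) ++ (rep (t.headD 0) (schedule K k c) ++ leafSteps k c t.tail)

theorem length_block (c : ℕ) : (block k c).length = k := by simp [block]

theorem block_eq (c : ℕ) (i : Fin k) :
    block k c = (block k c).take i ++ (c, i) :: (block k c).drop (i + 1) := by
  have h : (i : ℕ) < (block k c).length := by simp [length_block]
  have h2 : (block k c)[(i : ℕ)] = (c, i) := by simp [block]
  rw [← h2, List.cons_getElem_drop_succ, List.take_append_drop]

theorem expand_windows (c : ℕ) (i : Fin k) (d : ℕ) :
    expand (c + 1, i) (tailSteps K c i) (windows K c i d) = schedule K k (c + 1 + d) := by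
  induction d with
  | zero =>
    simp only [windows, expand_append, expand_map_some, expand, tailSteps, schedule,
      List.append_nil]
    conv_rhs => rw [block_eq (c + 1) i]
    simp
  | succ d ih =>
    simp only [windows, expand_append, expand_map_some, expand_rep, ih]
    rfl

theorem countP_rep {σ : Type*} (P : σ → Bool) (q : ℕ) (l : List σ) :
    (rep q l).countP P = q * l.countP P := by
  simp [rep, List.countP_flatten]

theorem countP_map_some {σ : Type*} (J : List σ) : (J.map some).countP Option.isNone = 0 := by
  simp [List.countP_eq_zero]

theorem countP_windows (c : ℕ) (i : Fin k) (d : ℕ) :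
    (windows K c i d).countP Option.isNone = K ^ d := by
  induction d with
  | zero => rw [windows, List.countP_append, countP_map_some]; rfl
  | succ d ih =>
    rw [windows, List.countP_append, countP_map_some, countP_rep, ih, pow_succ]
    ring

theorem leafSteps_prefix (c : ℕ) (t : List ℕ) (ht : ∀ q ∈ t, q < K) (hK : 0 < K) :
    ∃ l, schedule K k c = leafSteps K k c t ++ l := by
  induction c generalizing t with
  | zero => exact ⟨[], rfl⟩
  | succ c ih =>
    have hq : t.headD 0 < K := by cases t <;> simp_all
    obtain ⟨l, hl⟩ := ih t.tail fun q h => ht q (List.mem_of_mem_tail h)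
    obtain ⟨j, hj⟩ := Nat.exists_eq_add_of_lt hq
    refine ⟨l ++ rep j (schedule K k c), ?_⟩
    have : rep K (schedule K k c) = rep (t.headD 0) (schedule K k c) ++
        (schedule K k c ++ rep j (schedule K k c)) := by
      rw [← rep_succ, ← rep_add]
      congr 1
    rw [schedule, leafSteps, this]
    conv_lhs => rw [hl]
    simp only [List.append_assoc]
    rw [← hl]

variable (κ : ℕ × Fin k → Bool → α → PMF α)

/-- The expected total leak of the steps in the blocks above the leaf `t`, each seen at the end of
the schedule that its block starts. -/
noncomputable def pathLeaks : ℕ → List ℕ → α → ℝ≥0∞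
  | 0, _, _ => 0
  | c + 1, t, m => leaks κ (block k (c + 1)) (rep K (schedule K k c)) m +
      ex (run κ (block k (c + 1) ++ rep (t.headD 0) (schedule K k c)) m) (pathLeaks c t.tail)

/-- The chain rule along the path to a leaf: only the coins of the blocks above it are charged, each
at the cost `η ^ 2`; the subtrees passed on the way serve merely as random maps. -/
theorem pathLeaks_le {η : ℝ} (h0 : 0 ≤ η) (h1 : η ≤ 1) (hK : 0 < K) (c : ℕ) (t : List ℕ)
    (ht : ∀ q ∈ t, q < K) (m : α) :
    ENNReal.ofReal (η / 2) * pathLeaks K κ c t m ≤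
      ent (run κ (leafSteps K k c t) m) + (c * k : ℕ) * ENNReal.ofReal (η ^ 2) := by
  induction c generalizing t m with
  | zero => simp [pathLeaks]
  | succ c ih =>
    have ht' : ∀ q ∈ t.tail, q < K := fun q h => ht q (List.mem_of_mem_tail h)
    have e1 := info_append κ (ih t.tail ht') (rep (t.headD 0) (schedule K k c))
    have e2 := info_block κ h0 h1 e1 (block k (c + 1)) m
    rw [length_block] at e2
    obtain ⟨l, hl⟩ := leafSteps_prefix (k := k) K (c + 1) t ht hK
    -- The leaf comes before the end of the schedule, so by data processing the leak seen at the
    -- leaf is at least the one seen at the end.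
    rw [schedule, leafSteps, List.append_assoc, List.append_cancel_left_eq] at hl
    have e3 := leaks_append_le κ (block k (c + 1))
      (rep (t.headD 0) (schedule K k c) ++ leafSteps K k c t.tail) l m
    rw [← hl] at e3
    rw [← ex_run_append, ex_const_mul] at e2
    rw [pathLeaks, leafSteps, mul_add]
    calc _ ≤ ENNReal.ofReal (η / 2) * leaks κ (block k (c + 1))
          (rep (t.headD 0) (schedule K k c) ++ leafSteps K k c t.tail) m + _ := by gcongr
      _ ≤ _ := e2
      _ = _ := by push_cast; ring

/-- The sum over the addresses of the `K ^ c` leaves. -/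
noncomputable def leafSum : ℕ → (List ℕ → ℝ≥0∞) → ℝ≥0∞
  | 0, f => f []
  | c + 1, f => ∑ q ∈ Finset.range K, leafSum c fun t => f (q :: t)

theorem leafSum_le (c : ℕ) (f : List ℕ → ℝ≥0∞) (C : ℝ≥0∞)
    (h : ∀ t, (∀ q ∈ t, q < K) → f t ≤ C) : leafSum K c f ≤ K ^ c * C := by
  induction c generalizing f with
  | zero => simpa [leafSum] using h [] (by simp)
  | succ c ih =>
    calc _ ≤ ∑ q ∈ Finset.range K, (K : ℝ≥0∞) ^ c * C := by
          refine Finset.sum_le_sum fun q hq => ih _ fun t ht => h _ ?_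
          simpa using ⟨Finset.mem_range.1 hq, ht⟩
      _ = _ := by
        rw [Finset.sum_const, Finset.card_range, nsmul_eq_mul, pow_succ]
        ring

theorem leafSum_add (c : ℕ) (f g : List ℕ → ℝ≥0∞) :
    leafSum K c (fun t => f t + g t) = leafSum K c f + leafSum K c g := by
  induction c generalizing f g with
  | zero => rfl
  | succ c ih => simp only [leafSum, ih, Finset.sum_add_distrib]

theorem leafSum_const_mul (c : ℕ) (C : ℝ≥0∞) (f : List ℕ → ℝ≥0∞) :
    leafSum K c (fun t => C * f t) = C * leafSum K c f := by
  induction c generalizing f with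
  | zero => rfl
  | succ c ih => simp only [leafSum, ih, Finset.mul_sum]

theorem leafSum_const (c : ℕ) (C : ℝ≥0∞) : leafSum K c (fun _ => C) = K ^ c * C := by
  induction c with
  | zero => simp [leafSum]
  | succ c ih =>
    simp only [leafSum, ih, Finset.sum_const, Finset.card_range, nsmul_eq_mul, pow_succ]
    ring

theorem leafSum_ex (c : ℕ) (p : PMF α) (f : List ℕ → α → ℝ≥0∞) :
    leafSum K c (fun t => ex p (f t)) = ex p fun x => leafSum K c fun t => f t x := by
  induction c generalizing f with
  | zero => rfl
  | succ c ih =>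
    simp only [leafSum]
    rw [ex_sum]
    exact Finset.sum_congr rfl fun q _ => ih _

theorem leaks_block (c : ℕ) (m : α) :
    leaks κ (block k (c + 1)) (rep K (schedule K k c)) m =
      ∑ i : Fin k, windowLeaks κ (c + 1, i) (tailSteps K c i) (windows K c i 0) m := by
  rw [leaks_eq_sum]
  refine Fintype.sum_equiv (finCongr (length_block (c + 1))) _ _ fun j => ?_
  rw [windows, windowLeaks_map_some_append]
  have h2 : (block k (c + 1))[j] = (c + 1, finCongr (length_block (c + 1)) j) := by
    change (block k (c + 1))[(j : ℕ)] = _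
    simp only [block, List.getElem_map, List.getElem_finRange, Prod.mk.injEq, true_and]
    rfl
  rw [h2]
  congr 1
  funext x
  simp only [windowLeaks]
  rw [ex_const, add_zero]
  rfl

/-- Double counting: a block on level `a + 1` lies above exactly `K ^ (a + 1)` leaves, and its leak,
seen at the end of its own schedule, is the same for all of them. -/
theorem leafSum_pathLeaks (c : ℕ) (m : α) :
    leafSum K c (fun t => pathLeaks K κ c t m) =
      ∑ a ∈ Finset.range c, (K : ℝ≥0∞) ^ (a + 1) *
        ∑ i : Fin k, windowLeaks κ (a + 1, i) (tailSteps K a i) (windows K a i (c - 1 - a)) m := by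
  induction c generalizing m with
  | zero => simp [leafSum, pathLeaks]
  | succ c ih =>
    have e1 : leafSum K (c + 1) (fun t => pathLeaks K κ (c + 1) t m) =
        K ^ (c + 1) * leaks κ (block k (c + 1)) (rep K (schedule K k c)) m +
        ∑ q ∈ Finset.range K, ex (run κ (block k (c + 1) ++ rep q (schedule K k c)) m)
          (fun x => leafSum K c fun t => pathLeaks K κ c t x) := by
      simp only [pathLeaks]
      rw [leafSum_add, leafSum_const]
      congr 1
      simp only [leafSum, List.headD_cons, List.tail_cons]
      exact Finset.sum_congr rfl fun q _ => leafSum_ex K c _ _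
    rw [e1, Finset.sum_range_succ, add_comm, leaks_block]
    congr 1
    · simp only [funext ih, ex_sum, ex_const_mul]
      rw [Finset.sum_comm]
      refine Finset.sum_congr rfl fun a ha => ?_
      rw [← Finset.mul_sum, Finset.sum_comm]
      congr 1
      refine Finset.sum_congr rfl fun i _ => ?_
      have hac : a < c := Finset.mem_range.1 ha
      have h1 : c + 1 - 1 - a = (c - 1 - a) + 1 := by omega
      have h2 : a + 1 + (c - 1 - a) = c := by omega
      rw [h1, windows, windowLeaks_map_some_append, h2, funext (windowLeaks_rep κ _ _ _ _),
        ex_sum, expand_windows, h2]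
      exact Finset.sum_congr rfl fun q _ => ex_run_append κ _ _ _ _
    · simp

end tree

end RandomWalk

/-! ### Recorded coins and confused windows -/

namespace RandomWalk

variable {α ι Γ : Type*}

section ghost

variable (κ : ι → Bool → α → PMF α) (upd : ι → Bool → Γ → Γ)

/-- The expectation of `F` at the end of the steps `l`, where the coins are recorded by `upd`. -/
noncomputable def gex : List ι → (α → Γ → ℝ≥0∞) → α → Γ → ℝ≥0∞
  | [], F, m, γ => F m γ
  | p :: l, F, m, γ => ex coin fun b => ex (κ p b m) fun x => gex l F x (upd p b γ)

theorem gex_append (l l' : List ι) (F : α → Γ → ℝ≥0∞) (m : α) (γ : Γ) :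
    gex κ upd (l ++ l') F m γ = gex κ upd l (gex κ upd l' F) m γ := by
  induction l generalizing m γ with
  | nil => rfl
  | cons p l ih => simp only [List.cons_append, gex, ih]

theorem gex_mono (l : List ι) {F G : α → Γ → ℝ≥0∞} (h : ∀ m γ, F m γ ≤ G m γ) (m : α) (γ : Γ) :
    gex κ upd l F m γ ≤ gex κ upd l G m γ := by
  induction l generalizing m γ with
  | nil => exact h m γ
  | cons p l ih => exact ex_mono _ fun b => ex_mono _ fun x => ih _ _

theorem gex_add (l : List ι) (F G : α → Γ → ℝ≥0∞) (m : α) (γ : Γ) :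
    gex κ upd l (fun m γ => F m γ + G m γ) m γ = gex κ upd l F m γ + gex κ upd l G m γ := by
  induction l generalizing m γ with
  | nil => rfl
  | cons p l ih => simp only [gex, ih, ex_add]

theorem gex_const_mul (l : List ι) (c : ℝ≥0∞) (F : α → Γ → ℝ≥0∞) (m : α) (γ : Γ) :
    gex κ upd l (fun m γ => c * F m γ) m γ = c * gex κ upd l F m γ := by
  induction l generalizing m γ with
  | nil => rfl
  | cons p l ih => simp only [gex, ih, ex_const_mul]

theorem gex_of_state (l : List ι) (f : α → ℝ≥0∞) (m : α) (γ : Γ) :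
    gex κ upd l (fun m _ => f m) m γ = ex (run κ l m) f := by
  induction l generalizing m γ with
  | nil => simp [gex, run, ex_pure]
  | cons p l ih => simp only [gex, ih, run, ex_bind]

/-- Forgets the record during `l`, except for an invariant `P` that no step of `l` can break. -/
theorem ex_run_le_gex (l : List ι) (P : Γ → Prop)
    (hP : ∀ p ∈ l, ∀ b γ, P γ → P (upd p b γ)) (f : α → ℝ≥0∞) (F : α → Γ → ℝ≥0∞)
    (h : ∀ m γ, P γ → f m ≤ F m γ) (m : α) (γ : Γ) (hγ : P γ) :
    ex (run κ l m) f ≤ gex κ upd l F m γ := by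
  induction l generalizing m γ with
  | nil => simpa [gex, run, ex_pure] using h m γ hγ
  | cons p l ih =>
    simp only [gex, run, ex_bind]
    refine ex_mono _ fun b => ex_mono _ fun x => ih (fun q hq => hP q (by simp [hq])) _ _ ?_
    exact hP p (by simp) b γ hγ

end ghost

section windows

variable {k : ℕ} (K : ℕ) (κ : ℕ × Fin k → Bool → α → PMF α) (a : ℕ) (i : Fin k)

/-- For the counter `i`, record the sum of the increments on the levels above `a`, the sum of the
increments on the levels below `a`, and the number of the increments on the level `a`. -/
def record (p : ℕ × Fin k) (b : Bool) (γ : ℕ × ℕ × ℕ) : ℕ × ℕ × ℕ :=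
  if p.2 = i ∧ b = true then
    if p.1 < a then (γ.1, γ.2.1 + K ^ p.1, γ.2.2)
    else if p.1 = a then (γ.1, γ.2.1, γ.2.2 + 1) else (γ.1 + K ^ p.1, γ.2.1, γ.2.2)
  else γ

variable (post : List (ℕ × Fin k))

/-- The end `x` of a window that starts in `m` reveals little of the coin tossed in its first
step. -/
def Confused (m x : α) : Prop :=
  ∀ b, run κ ((a, i) :: post) m x ≤ 2 * ((κ (a, i) b m).bind (run κ post)) x

open Classical in
/-- The expectation of `F` of the state, of the sum of the increments on the levels above `a`, and of
the number of windows that are not confused. -/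
noncomputable def wex :
    List (Option (ℕ × Fin k)) → (α → ℕ → ℕ → ℝ≥0∞) → α → ℕ → ℕ → ℝ≥0∞
  | [], F, m, z, v => F m z v
  | some p :: s, F, m, z, v => ex coin fun b => ex (κ p b m) fun x =>
      wex s F x (if p.2 = i ∧ b = true then z + K ^ p.1 else z) v
  | none :: s, F, m, z, v => ex (run κ ((a, i) :: post) m) fun x =>
      wex s F x z (if Confused κ a i post m x then v else v + 1)

theorem wex_mono (s : List (Option (ℕ × Fin k))) {F G : α → ℕ → ℕ → ℝ≥0∞}
    (h : ∀ m z v, F m z v ≤ G m z v) (m : α) (z v : ℕ) :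
    wex K κ a i post s F m z v ≤ wex K κ a i post s G m z v := by
  induction s generalizing m z v with
  | nil => exact h m z v
  | cons o s ih =>
    cases o with
    | none => exact ex_mono _ fun x => ih _ _ _
    | some p => exact ex_mono _ fun b => ex_mono _ fun x => ih _ _ _

theorem wex_add (s : List (Option (ℕ × Fin k))) (F G : α → ℕ → ℕ → ℝ≥0∞) (m : α) (z v : ℕ) :
    wex K κ a i post s (fun m z v => F m z v + G m z v) m z v =
      wex K κ a i post s F m z v + wex K κ a i post s G m z v := by
  induction s generalizing m z v with
  | nil => rfl
  | cons o s ih => cases o <;> simp only [wex, ih, ex_add]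

theorem wex_const_mul (s : List (Option (ℕ × Fin k))) (c : ℝ≥0∞) (F : α → ℕ → ℕ → ℝ≥0∞)
    (m : α) (z v : ℕ) :
    wex K κ a i post s (fun m z v => c * F m z v) m z v = c * wex K κ a i post s F m z v := by
  induction s generalizing m z v with
  | nil => rfl
  | cons o s ih => cases o <;> simp only [wex, ih, ex_const_mul]

theorem wex_const (s : List (Option (ℕ × Fin k))) (c : ℝ≥0∞) (m : α) (z v : ℕ) :
    wex K κ a i post s (fun _ _ _ => c) m z v = c := by
  induction s generalizing m z v with
  | nil => rfl
  | cons o s ih => cases o <;> simp only [wex, ih, ex_const]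

theorem run_cons_apply (m x : α) :
    run κ ((a, i) :: post) m x = 2⁻¹ * (((κ (a, i) true m).bind (run κ post)) x +
      ((κ (a, i) false m).bind (run κ post)) x) := by
  rw [run, coin_bind_apply]

/-- The hypothesis says that one of the numbers exceeds three times the other; then their difference
is at least their mean. -/
theorem le_tsub_add_tsub {u v : ℝ≥0∞} (hu : u ≠ ∞) (hv : v ≠ ∞)
    (h : 2 * u < 2⁻¹ * (u + v) ∨ 2 * v < 2⁻¹ * (u + v)) :
    2⁻¹ * (u + v) ≤ (u - v) + (v - u) := by
  lift u to NNReal using hu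
  lift v to NNReal using hv
  have e2 : (2⁻¹ : ℝ≥0∞) = ((2⁻¹ : NNReal) : ℝ≥0∞) := by simp
  rw [e2] at h ⊢
  norm_cast at h ⊢
  rw [← NNReal.coe_le_coe]
  simp only [← NNReal.coe_lt_coe] at h
  push_cast at h ⊢
  rcases le_total u v with huv | huv
  · rw [tsub_eq_zero_of_le huv, NNReal.coe_sub huv, NNReal.coe_zero]
    have := NNReal.coe_le_coe.2 huv
    have := u.coe_nonneg
    rcases h with h | h <;> linarith
  · rw [tsub_eq_zero_of_le huv, NNReal.coe_sub huv, NNReal.coe_zero]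
    have := NNReal.coe_le_coe.2 huv
    have := v.coe_nonneg
    rcases h with h | h <;> linarith

open Classical in
theorem ex_not_confused_le (m : α) :
    ex (run κ ((a, i) :: post) m) (fun x => if Confused κ a i post m x then 0 else 1) ≤
      leak κ (a, i) post m := by
  refine ENNReal.tsum_le_tsum fun x => ?_
  dsimp only
  split_ifs with h
  · simp
  · rw [mul_one, run_cons_apply]
    refine le_tsub_add_tsub (PMF.apply_ne_top _ _) (PMF.apply_ne_top _ _) ?_
    simp only [Confused, Bool.forall_bool, not_and_or, not_le, run_cons_apply] at h
    exact h.symm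

/-- An end state that is not confused contributes at least its own probability to the leak, so the
total leak bounds the expected number of such windows. -/
theorem wex_not_confused_le (s : List (Option (ℕ × Fin k))) (m : α) (z v : ℕ) :
    wex K κ a i post s (fun _ _ v => (v : ℝ≥0∞)) m z v ≤
      v + windowLeaks κ (a, i) post s m := by
  classical
  induction s generalizing m z v with
  | nil => simp [wex]
  | cons o s ih =>
    cases o with
    | some p =>
      simp only [wex, windowLeaks]
      calc _ ≤ ex coin fun b => ex (κ p b m) fun x =>
            (v : ℝ≥0∞) + windowLeaks κ (a, i) post s x :=
            ex_mono _ fun b => ex_mono _ fun x => ih _ _ _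
        _ = _ := by simp only [ex_add, ex_const, run, ex_bind, ex_pure]
    | none =>
      simp only [wex, windowLeaks]
      calc _ ≤ ex (run κ ((a, i) :: post) m) fun x => ((v : ℝ≥0∞) +
            if Confused κ a i post m x then 0 else 1) + windowLeaks κ (a, i) post s x := by
            refine ex_mono _ fun x => (ih _ _ _).trans ?_
            gcongr
            split_ifs <;> simp
        _ ≤ _ := by
          rw [ex_add, ex_add, ex_const, add_assoc]
          gcongr
          exact ex_not_confused_le κ a i post m

/-- Whatever the state and the increments on the levels above `a`, the coins of all the confused
windows show `b₀` with a probability that is at least exponentially small in the number of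
windows. -/
theorem wex_le_gex (hpost : ∀ p ∈ post, p.2 = i → p.1 < a) (b₀ : Bool) (Q : ℕ → ℕ → ℕ → Prop)
    (hQ : ∀ u v r, Q u v (r + 1) → Q (if b₀ then u + 1 else u) v r)
    (hQ' : ∀ u v r (b : Bool), Q u v (r + 1) → Q (if b then u + 1 else u) (v + 1) r)
    (F : α → ℕ → ℕ → ℝ≥0∞) (G : α → ℕ → ℕ → ℝ≥0∞)
    (hFG : ∀ m z u v, Q u v 0 → F m z v ≤ G m z u) (s : List (Option (ℕ × Fin k)))
    (hs : ∀ p, some p ∈ s → p.2 = i → a < p.1) (m : α) (z y u v : ℕ)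
    (hq : Q u v (s.countP Option.isNone)) :
    4⁻¹ ^ (s.countP Option.isNone) * wex K κ a i post s F m z v ≤
      gex κ (record K a i) (expand (a, i) post s) (fun m γ => G m γ.1 γ.2.2) m (z, y, u) := by
  classical
  induction s generalizing m z y u v with
  | nil => simpa [wex, expand, gex] using hFG m z u v hq
  | cons o s ih =>
    have hs' : ∀ p, some p ∈ s → p.2 = i → a < p.1 := fun p hp => hs p (by simp [hp])
    cases o with
    | some p =>
      have hc : (some p :: s).countP Option.isNone = s.countP Option.isNone := by simp
      rw [hc] at hq ⊢
      simp only [wex, expand, gex]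
      rw [← ex_const_mul]
      refine ex_mono _ fun b => ?_
      rw [← ex_const_mul]
      refine ex_mono _ fun x => ?_
      have hr : record K a i p b (z, y, u) =
          (if p.2 = i ∧ b = true then z + K ^ p.1 else z, y, u) := by
        unfold record
        split_ifs with h h1 h2
        · exact absurd (hs p (by simp) h.1) (by omega)
        · exact absurd (hs p (by simp) h.1) (by omega)
        · rfl
        · rfl
      rw [hr]
      exact ih hs' _ _ _ _ _ hq
    | none =>
      have hc : (none :: s : List (Option (ℕ × Fin k))).countP Option.isNone =
          s.countP Option.isNone + 1 := by simp
      rw [hc] at hq ⊢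
      set r := s.countP Option.isNone
      simp only [wex, expand, List.cons_append, gex]
      -- At a confused end state only the branch `b = b₀` is kept: the coin costs `1/2` and its
      -- likelihood is at least half the mean, hence `1/4` per window. Otherwise both branches are
      -- kept at no cost.
      set D : α → Bool → ℝ≥0∞ := fun x b => 4⁻¹ ^ r * if Confused κ a i post m x then
        (if b = b₀ then wex K κ a i post s F x z v else 0)
        else wex K κ a i post s F x z (v + 1) with hD
      have step : ∀ b, ex ((κ (a, i) b m).bind (run κ post)) (fun x => D x b) ≤
          ex (κ (a, i) b m) fun x => gex κ (record K a i) (post ++ expand (a, i) post s)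
            (fun m γ => G m γ.1 γ.2.2) x (record K a i (a, i) b (z, y, u)) := by
        intro b
        have hr : record K a i (a, i) b (z, y, u) = (z, y, if b then u + 1 else u) := by
          cases b <;> simp [record]
        rw [ex_bind, hr]
        refine ex_mono _ fun x => ?_
        rw [gex_append]
        -- Within a window, the later steps of counter `i` are on levels below `a`, so they leave
        -- the first and third entries of the record alone.
        refine ex_run_le_gex κ (record K a i) post
          (fun γ => γ.1 = z ∧ γ.2.2 = if b then u + 1 else u) ?_ _ _ ?_ x _ ⟨rfl, rfl⟩
        · intro p hp b' γ hγ
          by_cases h : p.2 = i ∧ b' = true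
          · rw [record, if_pos h, if_pos (hpost p hp h.1)]
            exact hγ
          · rw [record, if_neg h]
            exact hγ
        · rintro x' ⟨z', y', u'⟩ ⟨h1, h2⟩
          simp only at h1 h2
          subst h1
          simp only [hD]
          split_ifs with hconf hb
          · refine ih hs' _ _ _ _ _ ?_
            rw [h2, hb]
            exact hQ u v r hq
          · simp
          · refine ih hs' _ _ _ _ _ ?_
            rw [h2]
            exact hQ' u v r b hq
      refine le_trans ?_ (ex_mono coin step)
      rw [ex_coin, ← ex_const_mul]
      unfold ex
      rw [← ENNReal.tsum_add, ← ENNReal.tsum_mul_left]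
      refine ENNReal.tsum_le_tsum fun x => ?_
      simp only [hD]
      split_ifs with hconf h1 h2 h2
      · exact absurd (h1.trans h2.symm) (by simp)
      · have := hconf true
        rw [mul_zero, mul_zero, add_zero]
        calc _ ≤ 2 * ((κ (a, i) true m).bind (run κ post)) x *
              (4⁻¹ ^ (r + 1) * wex K κ a i post s F x z v) := by gcongr
          _ = _ := by
            have e : (2 : ℝ≥0∞) * 4⁻¹ = 2⁻¹ := by
              rw [show (4 : ℝ≥0∞) = 2 * 2 by norm_num, ENNReal.mul_inv (by simp) (by simp),
                ← mul_assoc, ENNReal.mul_inv_cancel (by simp) (by simp), one_mul]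
            rw [pow_succ, ← e]
            ring
      · have := hconf false
        rw [mul_zero, mul_zero, zero_add]
        calc _ ≤ 2 * ((κ (a, i) false m).bind (run κ post)) x *
              (4⁻¹ ^ (r + 1) * wex K κ a i post s F x z v) := by gcongr
          _ = _ := by
            have e : (2 : ℝ≥0∞) * 4⁻¹ = 2⁻¹ := by
              rw [show (4 : ℝ≥0∞) = 2 * 2 by norm_num, ENNReal.mul_inv (by simp) (by simp),
                ← mul_assoc, ENNReal.mul_inv_cancel (by simp) (by simp), one_mul]
            rw [pow_succ, ← e]
            ring
      · cases b₀ <;> simp_all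
      · rw [← add_mul, ← mul_assoc 2⁻¹, ← run_cons_apply]
        have e : (4⁻¹ : ℝ≥0∞) ^ (r + 1) ≤ 4⁻¹ ^ r := by
          rw [pow_succ]
          exact mul_le_of_le_one_right' (by norm_num)
        gcongr

end windows

end RandomWalk

/-! ### Concentration of the lower levels -/

namespace RandomWalk

variable {α : Type*} {k : ℕ} (K : ℕ)

theorem sum_map_block {S : Type*} [AddCommMonoid S] (c : ℕ) (f : ℕ × Fin k → S) :
    ((block k c).map f).sum = ∑ i : Fin k, f (c, i) := by
  rw [block, List.map_map, ← List.ofFn_eq_map, List.sum_ofFn]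
  rfl

theorem sum_map_rep {ι S : Type*} [NonAssocSemiring S] (q : ℕ) (l : List ι) (f : ι → S) :
    ((rep q l).map f).sum = q * (l.map f).sum := by
  induction q with
  | zero => simp [rep]
  | succ q ih =>
    rw [rep_succ, List.map_append, List.sum_append, ih]
    push_cast
    rw [add_mul, one_mul, add_comm]

theorem sum_map_schedule_succ {S : Type*} [NonAssocSemiring S] (c : ℕ) (f : ℕ × Fin k → S) :
    ((schedule K k (c + 1)).map f).sum =
      ∑ i : Fin k, f (c + 1, i) + K * ((schedule K k c).map f).sum := by
  rw [schedule, List.map_append, List.sum_append, sum_map_block, sum_map_rep]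

theorem sum_increments_schedule (c : ℕ) :
    ((schedule K k c).map fun p => K ^ p.1).sum = k * (c * K ^ c) := by
  induction c with
  | zero => simp [schedule]
  | succ c ih =>
    rw [sum_map_schedule_succ, ih]
    simp
    ring

theorem sum_increments_schedule_of_eq (i : Fin k) (c : ℕ) :
    ((schedule K k c).map fun p => if p.2 = i then K ^ p.1 else 0).sum = c * K ^ c := by
  induction c with
  | zero => simp [schedule]
  | succ c ih =>
    rw [sum_map_schedule_succ, ih]
    simp
    ring

variable (a : ℕ) (i : Fin k)

/-- The expected sum of the increments of the counter `i` on the levels below `a`. -/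
noncomputable def lowMean (l : List (ℕ × Fin k)) : ℝ :=
  (l.map fun p => if p.2 = i ∧ p.1 < a then (K : ℝ) ^ p.1 / 2 else 0).sum

/-- Four times the variance of the sum of the increments of the counter `i` on the levels
below `a`. -/
noncomputable def lowVar (l : List (ℕ × Fin k)) : ℝ :=
  (l.map fun p => if p.2 = i ∧ p.1 < a then ((K : ℝ) ^ p.1) ^ 2 else 0).sum

/-- The recursion is `V (c + 1) = (K ^ (c + 1)) ^ 2 + K * V c`. The top level dominates because `2 *
K ≤ K ^ 2`. -/
theorem lowVar_schedule_le (hK : 2 ≤ K) (c : ℕ) (hc : c < a) :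
    lowVar K a i (schedule K k c) ≤ 2 * ((K : ℝ) ^ c) ^ 2 := by
  induction c with
  | zero => simp [schedule, lowVar]
  | succ c ih =>
    have h := ih (by omega)
    have h2 : ∑ j : Fin k, (if j = i ∧ c + 1 < a then ((K : ℝ) ^ (c + 1)) ^ 2 else 0) =
        ((K : ℝ) ^ (c + 1)) ^ 2 := by simp [hc]
    rw [lowVar, sum_map_schedule_succ]
    simp only
    rw [h2, ← lowVar]
    have hK' : (2 : ℝ) ≤ K := by exact_mod_cast hK
    have h3 : (K : ℝ) * lowVar K a i (schedule K k c) ≤ K * (2 * ((K : ℝ) ^ c) ^ 2) := by gcongr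
    have h4 : (K : ℝ) * (2 * ((K : ℝ) ^ c) ^ 2) ≤ K * (K * ((K : ℝ) ^ c) ^ 2) := by gcongr
    calc _ ≤ ((K : ℝ) ^ (c + 1)) ^ 2 + K * (K * ((K : ℝ) ^ c) ^ 2) := by linarith
      _ = _ := by ring

theorem lowVar_schedule (b d : ℕ) :
    lowVar K (b + 1) i (schedule K k (b + 1 + d)) =
      (K : ℝ) ^ (d + 1) * lowVar K (b + 1) i (schedule K k b) := by
  have hstep : ∀ c, b ≤ c → lowVar K (b + 1) i (schedule K k (c + 1)) =
      K * lowVar K (b + 1) i (schedule K k c) := by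
    intro c hc
    rw [lowVar, sum_map_schedule_succ, ← lowVar]
    simp [show ¬ (c < b) by omega]
  induction d with
  | zero => rw [add_zero, hstep b le_rfl]; simp
  | succ d ih =>
    rw [← add_assoc, hstep _ (by omega), ih, pow_succ _ (d + 1)]
    ring

variable (κ : ℕ × Fin k → Bool → α → PMF α)

/-- Hoeffding's lemma for a fair coin: centre it and use `cosh y ≤ exp (y ^ 2 / 2)`. -/
theorem exp_add_one_le (x : ℝ) : (Real.exp x + 1) / 2 ≤ Real.exp (x / 2 + x ^ 2 / 8) := by
  have h := Real.cosh_le_exp_half_sq (x / 2)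
  rw [Real.cosh_eq] at h
  have e1 : Real.exp x = Real.exp (x / 2) * Real.exp (x / 2) := by rw [← Real.exp_add]; ring_nf
  have e2 : 1 = Real.exp (x / 2) * Real.exp (-(x / 2)) := by rw [← Real.exp_add]; simp
  have e3 : Real.exp (x / 2 + x ^ 2 / 8) = Real.exp (x / 2) * Real.exp ((x / 2) ^ 2 / 2) := by
    rw [← Real.exp_add]; ring_nf
  rw [e3, e1]
  have := mul_le_mul_of_nonneg_left h (Real.exp_pos (x / 2)).le
  linarith

theorem gex_exp_le (t : ℝ) (l : List (ℕ × Fin k)) (m : α) (γ : ℕ × ℕ × ℕ) :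
    gex κ (record K a i) l (fun _ γ => ENNReal.ofReal (Real.exp (t * γ.2.1))) m γ ≤
      ENNReal.ofReal (Real.exp (t * (γ.2.1 + lowMean K a i l) + t ^ 2 / 8 * lowVar K a i l)) := by
  induction l generalizing m γ with
  | nil => simp [gex, lowMean, lowVar]
  | cons p l ih =>
    simp only [gex]
    have h1 : ∀ b, ex (κ p b m) (fun x => gex κ (record K a i) l
        (fun _ γ => ENNReal.ofReal (Real.exp (t * γ.2.1))) x (record K a i p b γ)) ≤
        ENNReal.ofReal (Real.exp (t * ((record K a i p b γ).2.1 + lowMean K a i l) +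
          t ^ 2 / 8 * lowVar K a i l)) := fun b =>
      (ex_mono _ fun x => ih x _).trans_eq (ex_const _ _)
    refine (ex_mono coin h1).trans ?_
    rw [ex_coin]
    have h2 : (2⁻¹ : ℝ≥0∞) = ENNReal.ofReal 2⁻¹ := by
      rw [ENNReal.ofReal_inv_of_pos (by norm_num)]; simp
    rw [h2, ← ENNReal.ofReal_add (Real.exp_pos _).le (Real.exp_pos _).le,
      ← ENNReal.ofReal_mul (by norm_num)]
    apply ENNReal.ofReal_le_ofReal
    have hm : lowMean K a i (p :: l) =
      (if p.2 = i ∧ p.1 < a then (K : ℝ) ^ p.1 / 2 else 0) + lowMean K a i l := by simp [lowMean]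
    have hv : lowVar K a i (p :: l) =
      (if p.2 = i ∧ p.1 < a then ((K : ℝ) ^ p.1) ^ 2 else 0) + lowVar K a i l := by simp [lowVar]
    have hf : (record K a i p false γ).2.1 = γ.2.1 := by simp [record]
    rw [hm, hv, hf]
    by_cases h : p.2 = i ∧ p.1 < a
    · have ht : (record K a i p true γ).2.1 = γ.2.1 + K ^ p.1 := by simp [record, h.1, h.2]
      rw [ht, if_pos h, if_pos h]
      push_cast
      set x : ℝ := (K : ℝ) ^ p.1
      set E := Real.exp (t * (γ.2.1 + lowMean K a i l) + t ^ 2 / 8 * lowVar K a i l)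
      have e1 : Real.exp (t * (γ.2.1 + x + lowMean K a i l) + t ^ 2 / 8 * lowVar K a i l) =
          E * Real.exp (t * x) := by rw [← Real.exp_add]; ring_nf
      have e2 : Real.exp (t * (γ.2.1 + (x / 2 + lowMean K a i l)) +
          t ^ 2 / 8 * (x ^ 2 + lowVar K a i l)) = E * Real.exp (t * x / 2 + (t * x) ^ 2 / 8) := by
        rw [← Real.exp_add]; ring_nf
      rw [e1, e2]
      have := mul_le_mul_of_nonneg_left (exp_add_one_le (t * x)) (Real.exp_pos _ : 0 < E).le
      linarith
    · have ht : (record K a i p true γ).2.1 = γ.2.1 := by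
        unfold record
        split_ifs with h1 h2 h2
        · exact absurd ⟨h1.1, h2⟩ h
        all_goals rfl
      rw [ht, if_neg h, if_neg h, zero_add, zero_add]
      linarith

/-- Chernoff's bound for both tails, uniform in the initial memory since the recorded coins do not
depend on it. -/
theorem gex_deviation_le {t d : ℝ} (ht : 0 ≤ t) (l : List (ℕ × Fin k)) (m : α) :
    gex κ (record K a i) l
      (fun _ γ => if d < |(γ.2.1 : ℝ) - lowMean K a i l| then 1 else 0) m (0, 0, 0) ≤
      ENNReal.ofReal (2 * Real.exp (t ^ 2 / 8 * lowVar K a i l - t * d)) := by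
  set M := lowMean K a i l
  set V := lowVar K a i l
  have hpt : ∀ (m : α) (γ : ℕ × ℕ × ℕ), (if d < |(γ.2.1 : ℝ) - M| then (1 : ℝ≥0∞) else 0) ≤
      ENNReal.ofReal (Real.exp (-(t * (M + d)))) * ENNReal.ofReal (Real.exp (t * γ.2.1)) +
      ENNReal.ofReal (Real.exp (t * (M - d))) * ENNReal.ofReal (Real.exp (-t * γ.2.1)) := by
    intro _ γ
    split_ifs with h
    · rw [← ENNReal.ofReal_mul (Real.exp_pos _).le, ← ENNReal.ofReal_mul (Real.exp_pos _).le,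
        ← Real.exp_add, ← Real.exp_add,
        ← ENNReal.ofReal_add (Real.exp_pos _).le (Real.exp_pos _).le, ENNReal.one_le_ofReal]
      rcases lt_abs.1 h with h | h
      · have : 0 ≤ -(t * (M + d)) + t * γ.2.1 := by nlinarith
        have := Real.one_le_exp this
        have := Real.exp_pos (t * (M - d) + -t * γ.2.1)
        linarith
      · have : 0 ≤ t * (M - d) + -t * γ.2.1 := by nlinarith
        have := Real.one_le_exp this
        have := Real.exp_pos (-(t * (M + d)) + t * γ.2.1)
        linarith
    · exact zero_le
  refine (gex_mono κ _ l hpt m _).trans ?_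
  rw [gex_add, gex_const_mul, gex_const_mul]
  refine (add_le_add (mul_le_mul_right (gex_exp_le K a i κ t l m _) _)
    (mul_le_mul_right (gex_exp_le K a i κ (-t) l m _) _)).trans ?_
  rw [← ENNReal.ofReal_mul (Real.exp_pos _).le, ← ENNReal.ofReal_mul (Real.exp_pos _).le,
    ← Real.exp_add, ← Real.exp_add, ← ENNReal.ofReal_add (Real.exp_pos _).le (Real.exp_pos _).le]
  apply ENNReal.ofReal_le_ofReal
  rw [two_mul]
  apply le_of_eq
  congr 2 <;> (push_cast; ring)

end RandomWalk

/-! ### From random runs to deterministic streams -/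

namespace CounterAlgorithm

open RandomWalk

variable {k : ℕ} (A : CounterAlgorithm k)

/-- The law of the memory state after the increments `w`, starting from `m`. -/
noncomputable def lawFrom (m : List Bool) (w : List (Fin k)) : PMF (List Bool) :=
  w.foldl (fun p i => p.bind (A.increment i)) (PMF.pure m)

theorem foldl_bind (p : PMF (List Bool)) (w : List (Fin k)) :
    w.foldl (fun p i => p.bind (A.increment i)) p = p.bind fun m => A.lawFrom m w := by
  induction w using List.reverseRecOn with
  | nil => simp [lawFrom]
  | append_singleton w i ih =>
    simp only [lawFrom, List.foldl_append, List.foldl_cons, List.foldl_nil] at ih ⊢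
    rw [ih, PMF.bind_bind]

theorem law_append (w v : List (Fin k)) :
    A.law (w ++ v) = (A.law w).bind fun m => A.lawFrom m v := by
  rw [law, List.foldl_append, foldl_bind]
  rfl

/-- The step `(c, i)`: increment the counter `i` either `K ^ c` times or not at all. -/
noncomputable def step (K : ℕ) (p : ℕ × Fin k) (b : Bool) (m : List Bool) : PMF (List Bool) :=
  A.lawFrom m (List.replicate (if b then K ^ p.1 else 0) p.2)

theorem ex_comm {α β : Type*} (p : PMF α) (q : PMF β) (f : α → β → ℝ≥0∞) :
    ex p (fun x => ex q (f x)) = ex q fun y => ex p fun x => f x y := by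
  unfold ex
  simp only [← ENNReal.tsum_mul_left]
  rw [ENNReal.tsum_comm]
  simp only [mul_left_comm]

/-- Fixing all coins gives a deterministic stream whose count of `i` can be read off the record. A
bound valid for every such stream survives averaging over the coins. -/
theorem ex_law_gex_le (K a : ℕ) (i : Fin k) (F : List Bool → ℕ × ℕ × ℕ → ℝ≥0∞) (C : ℝ≥0∞)
    (l : List (ℕ × Fin k)) (w : List (Fin k)) (γ : ℕ × ℕ × ℕ)
    (hw : w.count i = 1 + γ.1 + γ.2.1 + K ^ a * γ.2.2)
    (h : ∀ (v : List (Fin k)) (γ' : ℕ × ℕ × ℕ), v.length ≤ (l.map fun p => K ^ p.1).sum →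
      v.count i ≤ (l.map fun p => if p.2 = i then K ^ p.1 else 0).sum →
      (w ++ v).count i = 1 + γ'.1 + γ'.2.1 + K ^ a * γ'.2.2 →
      ex (A.law (w ++ v)) (fun m => F m γ') ≤ C) :
    ex (A.law w) (fun m => gex (A.step K) (record K a i) l F m γ) ≤ C := by
  induction l generalizing w γ with
  | nil => simpa [gex] using h [] γ (by simp) (by simp) (by simpa using hw)
  | cons p l ih =>
    simp only [gex]
    rw [ex_comm, ← ex_const coin C]
    refine ex_mono _ fun b => ?_
    set v₀ := List.replicate (if b then K ^ p.1 else 0) p.2 with hv₀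
    have hlen : v₀.length ≤ K ^ p.1 := by cases b <;> simp [hv₀]
    have hcnt : v₀.count i ≤ if p.2 = i then K ^ p.1 else 0 := by
      rw [hv₀, List.count_replicate]
      by_cases hp : p.2 = i <;> cases b <;> simp [hp]
    have hw' : (w ++ v₀).count i = 1 + (record K a i p b γ).1 + (record K a i p b γ).2.1 +
        K ^ a * (record K a i p b γ).2.2 := by
      rw [List.count_append, hw, hv₀, List.count_replicate]
      unfold record
      by_cases hp : p.2 = i
      · cases b
        · simp [hp]
        · rcases lt_trichotomy p.1 a with h1 | h1 | h1
          · simp [hp, h1]; ring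
          · simp [hp, h1]; ring
          · simp [hp, h1.not_gt, h1.ne']; ring
      · simp [hp]
    have := ih (w ++ v₀) (record K a i p b γ) hw' fun v γ' h1 h2 h3 => by
      rw [List.append_assoc] at h3 ⊢
      refine h _ γ' ?_ ?_ h3
      · rw [List.length_append, List.map_cons, List.sum_cons]
        exact add_le_add hlen h1
      · rw [List.count_append, List.map_cons, List.sum_cons]
        exact add_le_add hcnt h2
    rw [law_append, ex_bind] at this
    exact this

end CounterAlgorithm

/-! ### Levels occurring inside and outside windows -/

namespace RandomWalk

variable {k : ℕ} (K : ℕ)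

theorem mem_rep {α : Type*} {q : ℕ} {l : List α} {x : α} (h : x ∈ rep q l) : x ∈ l := by
  simp only [rep, List.mem_flatten, List.mem_replicate] at h
  obtain ⟨l', ⟨-, rfl⟩, h⟩ := h
  exact h

theorem fst_of_mem_block {c : ℕ} {p : ℕ × Fin k} (h : p ∈ block k c) : p.1 = c := by
  simp only [block, List.mem_map] at h
  obtain ⟨i, -, rfl⟩ := h
  rfl

theorem fst_le_of_mem_schedule {c : ℕ} {p : ℕ × Fin k} (h : p ∈ schedule K k c) : p.1 ≤ c := by
  induction c with
  | zero => simp [schedule] at h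
  | succ c ih =>
    rcases List.mem_append.1 h with h | h
    · exact (fst_of_mem_block h).le
    · exact (ih (mem_rep h)).trans (Nat.le_succ c)

theorem fst_lt_of_mem_tailSteps (b : ℕ) (i : Fin k) :
    ∀ p ∈ tailSteps K b i, p.2 = i → p.1 < b + 1 := by
  intro p hp hi
  rcases List.mem_append.1 hp with h | h
  · obtain ⟨j, hj, rfl⟩ := List.mem_iff_getElem.1 h
    simp only [block, List.getElem_drop, List.getElem_map, List.getElem_finRange, Fin.ext_iff] at hi
    simp at hi
    omega
  · exact Nat.lt_succ_of_le (fst_le_of_mem_schedule K (mem_rep h))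

/-- On level `b + 1` the steps outside the windows come before `i` in their block, so they belong to
other counters. -/
theorem lt_fst_of_mem_windows (b : ℕ) (i : Fin k) (d : ℕ) :
    ∀ p, some p ∈ windows K b i d → p.2 = i → b + 1 < p.1 := by
  induction d with
  | zero =>
    intro p hp hi
    simp only [windows, List.mem_append, List.mem_map, Option.some.injEq, exists_eq_right,
      List.mem_singleton, reduceCtorEq, or_false] at hp
    obtain ⟨j, hj, rfl⟩ := List.mem_iff_getElem.1 hp
    simp only [block, List.getElem_take, List.getElem_map, List.getElem_finRange,
      Fin.ext_iff] at hi
    simp [block] at hi hj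
    omega
  | succ d ih =>
    intro p hp hi
    rcases List.mem_append.1 hp with h | h
    · simp only [List.mem_map, Option.some.injEq, exists_eq_right] at h
      have := fst_of_mem_block h
      omega
    · exact ih p (mem_rep h) hi

end RandomWalk

/-! ### Correctness forces leaks on every level -/

namespace CounterAlgorithm

open RandomWalk MeasureTheory

variable {k : ℕ} (A : CounterAlgorithm k)

theorem exp_neg_lt (r : ℝ) (n : ℕ) (hn : 1 ≤ n) (hr : r ≤ Real.exp (-(10 * n))) :
    2 * r + 4 * Real.exp (-(10 * n)) < 4⁻¹ ^ n * (3 / 4) := by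
  have h1 : Real.exp (-(10 * n)) = (Real.exp (-10)) ^ n := by
    rw [← Real.exp_nat_mul]; ring_nf
  have h2 : Real.exp (-10) ≤ 4⁻¹ * 16⁻¹ := by
    have h3 : (2 : ℝ) ≤ Real.exp 1 := by
      have := Real.add_one_le_exp 1
      linarith
    have h4 : Real.exp 10 = Real.exp 1 ^ 10 := by rw [← Real.exp_nat_mul]; norm_num
    have h5 : (2 : ℝ) ^ 10 ≤ Real.exp 1 ^ 10 := by gcongr
    rw [Real.exp_neg, ← mul_inv, h4]
    gcongr
    linarith
  have h6 : (Real.exp (-10)) ^ n ≤ 4⁻¹ ^ n * 16⁻¹ := by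
    calc _ ≤ (4⁻¹ * 16⁻¹ : ℝ) ^ n := by gcongr
      _ = 4⁻¹ ^ n * 16⁻¹ ^ n := mul_pow _ _ _
      _ ≤ 4⁻¹ ^ n * 16⁻¹ := by
        gcongr
        exact pow_le_of_le_one (by norm_num) (by norm_num) (by omega)
  have h7 : (0 : ℝ) < 4⁻¹ ^ n := by positivity
  rw [h1] at hr ⊢
  linarith

/-- The windows on each level leak much: otherwise the counter `i` could have two values that are
far apart and that the memory cannot tell apart with the required certainty. -/
theorem lt_ex_windowLeaks {K b d n : ℕ} {ε δ : ℝ} (hA : A.IsApproximateCounter ε δ n) (i : Fin k)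
    (hK : 1000 ≤ K) (hn : k + k * ((b + 1 + d) * K ^ (b + 1 + d)) ≤ n) (hε : 0 ≤ ε)
    (hε' : ε * (1 + (b + 1 + d : ℕ) * (K : ℝ) ^ (b + 1 + d)) ≤ 3 / 10 * (K : ℝ) ^ (b + 1 + d))
    (hδ : δ ≤ Real.exp (-(10 * (K ^ d : ℕ)))) :
    ENNReal.ofReal ((K ^ d : ℕ) / 40) < ex (A.law (List.finRange k))
      (windowLeaks (A.step K) (b + 1, i) (tailSteps K b i) (windows K b i d)) := by
  classical
  by_contra! hD
  set T := b + 1 + d with hT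
  set R := K ^ d with hR
  have hKpos : 0 < K := by omega
  have hRpos : 1 ≤ R := Nat.one_le_pow _ _ hKpos
  set κ := A.step K
  set post := tailSteps K b i
  set s := windows K b i d with hs
  set μ := A.law (List.finRange k)
  set l := schedule K k T with hl
  have hexp : expand (b + 1, i) post s = l := expand_windows K b i d
  have hcount : s.countP Option.isNone = R := countP_windows K b i d
  set M := lowMean K (b + 1) i l
  set w := fun (F : List Bool → ℕ → ℕ → ℝ≥0∞) m => wex K κ (b + 1) i post s F m 0 0 with hw
  set g := fun (F : List Bool → ℕ × ℕ × ℕ → ℝ≥0∞) m => gex κ (record K (b + 1) i) l F m (0, 0, 0)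
    with hg
  -- The threshold between the two cases: given `z`, and with typical lower levels, the count is at
  -- least `3/10 * K ^ T` below it when at most a tenth of the coins are 1, and as far above it when
  -- at least nine tenths are.
  set mid : ℕ → ℝ := fun z => 1 + z + M + (K : ℝ) ^ T / 2 with hmid
  set q : List Bool → Measure ℝ := fun m => (A.query i m : Measure ℝ) with hq
  set hi : List Bool → ℕ → ℝ≥0∞ := fun m z => q m {x | mid z < x} with hhi
  set lo : List Bool → ℕ → ℝ≥0∞ := fun m z => q m {x | x ≤ mid z} with hlo
  have hsum : ∀ m z, hi m z + lo m z = 1 := by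
    intro m z
    have hc : {x : ℝ | x ≤ mid z} = {x | mid z < x}ᶜ := by ext; simp
    simp only [hhi, hlo, hc]
    have : IsProbabilityMeasure (q m) := (A.query i m).2
    exact prob_add_prob_compl (measurableSet_lt measurable_const measurable_id)
  -- Markov: the expected number of windows that are not confused is at most `R / 40`, so more than
  -- `R / 10` occur with probability at most `1/4`.
  have h1 : ENNReal.ofReal (3 / 4) ≤
      ex μ (w fun _ _ v => if 10 * v ≤ R then 1 else 0) := by
    have e1 : ∀ m, (R : ℝ≥0∞) ≤ R * w (fun _ _ v => if 10 * v ≤ R then 1 else 0) m +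
        10 * windowLeaks κ (b + 1, i) post s m := by
      intro m
      have e2 : w (fun _ _ _ => (R : ℝ≥0∞)) m = R := wex_const ..
      have e3 : w (fun _ _ v => (v : ℝ≥0∞)) m ≤ windowLeaks κ (b + 1, i) post s m := by
        have := wex_not_confused_le K κ (b + 1) i post s m 0 0
        simpa using this
      calc (R : ℝ≥0∞) = w (fun _ _ _ => (R : ℝ≥0∞)) m := e2.symm
        _ ≤ w (fun _ _ v => R * (if 10 * v ≤ R then 1 else 0) + 10 * (v : ℝ≥0∞)) m := by
          refine wex_mono K κ _ i post s (fun _ _ v => ?_) m 0 0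
          split_ifs with h
          · simp
          · rw [mul_zero, zero_add]
            have : R ≤ 10 * v := by omega
            exact_mod_cast this
        _ = R * w (fun _ _ v => if 10 * v ≤ R then 1 else 0) m +
            10 * w (fun _ _ v => (v : ℝ≥0∞)) m := by
          simp only [hw]
          rw [wex_add, wex_const_mul, wex_const_mul]
        _ ≤ _ := by gcongr
    have e4 := ex_mono μ e1
    rw [ex_const, ex_add, ex_const_mul, ex_const_mul] at e4
    have hX : ex μ (w fun _ _ v => if 10 * v ≤ R then 1 else 0) ≠ ∞ := by
      refine ne_top_of_le_ne_top ENNReal.one_ne_top ?_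
      calc _ ≤ ex μ (fun _ => (1 : ℝ≥0∞)) := by
            refine ex_mono μ fun m => ?_
            have := wex_mono K κ (b + 1) i post s (F := fun _ _ v => if 10 * v ≤ R then 1 else 0)
              (G := fun _ _ _ => 1) (fun _ _ v => by split_ifs <;> simp) m 0 0
            rwa [wex_const] at this
        _ = 1 := ex_const _ _
    have e5 := e4.trans (add_le_add_right (mul_le_mul_right hD 10) _)
    generalize ex μ (w fun _ _ v => if 10 * v ≤ R then 1 else 0) = X at e5 hX ⊢
    lift X to NNReal using hX
    have e6 : (R : ℝ) ≤ R * X + 10 * (R / 40) := by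
      have e7 := ENNReal.toReal_mono (by finiteness) e5
      rw [ENNReal.toReal_add (by finiteness) (by finiteness)] at e7
      simp only [ENNReal.toReal_mul, ENNReal.toReal_natCast, ENNReal.coe_toReal,
        ENNReal.toReal_ofNat] at e7
      rwa [ENNReal.toReal_ofReal (by positivity)] at e7
    have hR1 : (1 : ℝ) ≤ R := by exact_mod_cast hRpos
    refine ENNReal.ofReal_le_of_le_toReal ?_
    rw [ENNReal.coe_toReal]
    by_contra! h
    nlinarith
  have h2 : ∀ m, 4⁻¹ ^ R * w (fun m z v => if 10 * v ≤ R then hi m z else 0) m ≤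
      g (fun m γ => if 10 * γ.2.2 ≤ R then hi m γ.1 else 0) m := by
    intro m
    -- With `b₀ = false` a coin can show 1 only in a window that is not confused, hence the
    -- invariant `u ≤ v`.
    have := wex_le_gex K κ (b + 1) i post (fst_lt_of_mem_tailSteps K b i) false
      (fun u v _ => u ≤ v) (by simp) (by intro u v _ c; cases c <;> simp <;> omega)
      (fun m z v => if 10 * v ≤ R then hi m z else 0)
      (fun m z u => if 10 * u ≤ R then hi m z else 0)
      (by
        intro m z u v huv
        split_ifs with h h'
        · exact le_rfl
        · omega
        · exact zero_le
        · exact le_rfl)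
      s (lt_fst_of_mem_windows K b i d) m 0 0 0 0 le_rfl
    rwa [hcount, hexp] at this
  have h3 : ∀ m, 4⁻¹ ^ R * w (fun m z v => if 10 * v ≤ R then lo m z else 0) m ≤
      g (fun m γ => if 9 * R ≤ 10 * γ.2.2 then lo m γ.1 else 0) m := by
    intro m
    have := wex_le_gex K κ (b + 1) i post (fst_lt_of_mem_tailSteps K b i) true
      (fun u v r => R ≤ u + v + r) (by intro u v r; simp; omega)
      (by intro u v r c; cases c <;> simp <;> omega)
      (fun m z v => if 10 * v ≤ R then lo m z else 0)
      (fun m z u => if 9 * R ≤ 10 * u then lo m z else 0)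
      (by
        intro m z u v huv
        split_ifs with h h'
        · exact le_rfl
        · omega
        · exact zero_le
        · exact le_rfl)
      s (lt_fst_of_mem_windows K b i d) m 0 0 0 0 (by rw [hcount]; omega)
    rwa [hcount, hexp] at this
  set val : ℕ × ℕ × ℕ → ℕ := fun γ => 1 + γ.1 + γ.2.1 + K ^ (b + 1) * γ.2.2 with hval
  -- The default 1 covers records too large to arise from the schedule; it makes `h4` and `h5` hold
  -- for every record.
  set f : List Bool → ℕ × ℕ × ℕ → ℝ≥0∞ := fun m γ => if val γ ≤ 1 + T * K ^ T then
    q m {x | ε * (val γ : ℝ) ≤ |x - (val γ : ℝ)|} else 1 with hf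
  set dev : List Bool → ℕ × ℕ × ℕ → ℝ≥0∞ := fun _ γ =>
    if (K : ℝ) ^ T / 10 < |(γ.2.1 : ℝ) - M| then 1 else 0 with hdev
  have hKT : (K : ℝ) ^ T = K ^ (b + 1) * R := by
    rw [hT, hR]; push_cast; rw [pow_add]
  have hq1 : ∀ m (S : Set ℝ), q m S ≤ 1 := by
    intro m S
    have : IsProbabilityMeasure (q m) := (A.query i m).2
    exact prob_le_one
  have hεval : ∀ γ, val γ ≤ 1 + T * K ^ T → ε * (val γ : ℝ) ≤ 3 / 10 * (K : ℝ) ^ T := by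
    intro γ h
    refine le_trans ?_ hε'
    gcongr
    exact_mod_cast h
  have hvalR : ∀ γ : ℕ × ℕ × ℕ, (val γ : ℝ) = 1 + γ.1 + γ.2.1 + (K : ℝ) ^ (b + 1) * γ.2.2 := by
    intro γ; simp only [hval]; push_cast; ring
  have hKb : (0 : ℝ) < (K : ℝ) ^ (b + 1) := by positivity
  have h4 : ∀ m γ, (if 10 * γ.2.2 ≤ R then hi m γ.1 else 0) ≤ f m γ + dev m γ := by
    intro m γ
    split_ifs with hu
    swap
    · exact zero_le
    simp only [hf, hdev]
    split_ifs with h h' h'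
    · exact (hq1 _ _).trans le_add_self
    · rw [add_zero]
      refine measure_mono fun x hx => ?_
      simp only [Set.mem_ofPred_eq, hmid] at hx ⊢
      refine (hεval γ h).trans (le_trans ?_ (le_abs_self _))
      rw [hvalR]
      have e1 := (abs_le.1 (not_lt.1 h')).2
      have e2 : (K : ℝ) ^ (b + 1) * (10 * γ.2.2) ≤ K ^ (b + 1) * R := by
        gcongr; exact_mod_cast hu
      rw [← hKT] at e2
      linarith
    · exact (hq1 _ _).trans le_self_add
    · exact (hq1 _ _).trans le_self_add
  have h5 : ∀ m γ, (if 9 * R ≤ 10 * γ.2.2 then lo m γ.1 else 0) ≤ f m γ + dev m γ := by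
    intro m γ
    split_ifs with hu
    swap
    · exact zero_le
    simp only [hf, hdev]
    split_ifs with h h' h'
    · exact (hq1 _ _).trans le_add_self
    · rw [add_zero]
      refine measure_mono fun x hx => ?_
      simp only [Set.mem_ofPred_eq, hmid] at hx ⊢
      refine (hεval γ h).trans (le_trans ?_ (neg_le_abs _))
      rw [hvalR]
      have e1 := (abs_le.1 (not_lt.1 h')).1
      have hu' : (9 * R : ℝ) ≤ 10 * γ.2.2 := by exact_mod_cast hu
      have e2 := mul_le_mul_of_nonneg_left hu' hKb.le
      have e3 : (K : ℝ) ^ (b + 1) * (9 * R) = 9 * (K : ℝ) ^ T := by rw [hKT]; ring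
      rw [e3] at e2
      linarith
    · exact (hq1 _ _).trans le_self_add
    · exact (hq1 _ _).trans le_self_add
  have h6 : ex μ (g f) ≤ ENNReal.ofReal δ := by
    -- The initial stream increments every counter once, so no counter is exempt from the
    -- requirement; this is the `1` in `val` and `mid`.
    refine A.ex_law_gex_le K (b + 1) i f _ l (List.finRange k) (0, 0, 0) ?_ ?_
    · simp
    · intro v γ hv1 hv2 hv3
      rw [hl, sum_increments_schedule] at hv1
      rw [hl, sum_increments_schedule_of_eq] at hv2
      have hc1 : (List.finRange k).count i = 1 :=
        List.count_eq_one_of_mem (List.nodup_finRange k) (List.mem_finRange i)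
      have hc : (List.finRange k ++ v).count i = val γ := hv3
      have hle : val γ ≤ 1 + T * K ^ T := by
        rw [← hc, List.count_append, hc1]
        omega
      have := hA (List.finRange k ++ v) (by simp; omega) i (by rw [hc]; simp only [hval]; omega)
      rw [failureProb, hc] at this
      simp only [hf, if_pos hle]
      exact this
  have h7 : ∀ m, g dev m ≤ ENNReal.ofReal (2 * Real.exp (-(10 * R))) := by
    intro m
    have hKR : (1000 : ℝ) ≤ K := by exact_mod_cast hK
    -- This `t` gives the exponent `K * R / 100 - K * R / 50`, at most `-10 * R` because `K ≥ 1000`.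
    set t : ℝ := K / 5 / K ^ (b + 1) with ht
    have hdevb := gex_deviation_le K (b + 1) i κ (t := t) (d := (K : ℝ) ^ T / 10) (by positivity) l m
    refine hdevb.trans (ENNReal.ofReal_le_ofReal ?_)
    gcongr
    have hv : lowVar K (b + 1) i l ≤ 2 * (R * K * ((K : ℝ) ^ b) ^ 2) := by
      rw [hl, hT, lowVar_schedule]
      have := lowVar_schedule_le K (b + 1) i (by omega) b (by omega)
      calc _ ≤ (K : ℝ) ^ (d + 1) * (2 * ((K : ℝ) ^ b) ^ 2) := by gcongr
        _ = _ := by rw [hR]; push_cast; ring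
    have hv2 : t ^ 2 / 8 * lowVar K (b + 1) i l ≤ t ^ 2 / 8 * (2 * (R * K * ((K : ℝ) ^ b) ^ 2)) := by
      gcongr
    have hv3 : t ^ 2 / 8 * (2 * (R * K * ((K : ℝ) ^ b) ^ 2)) = K * R / 100 := by
      rw [ht, pow_succ (K : ℝ) b]
      field_simp
      norm_num
    have hv4 : t * ((K : ℝ) ^ T / 10) = K * R / 50 := by
      rw [ht, hKT]
      field_simp
      norm_num
    have hv5 : (1000 : ℝ) * R ≤ K * R := by gcongr
    linarith
  have h8 : 4⁻¹ ^ R * ENNReal.ofReal (3 / 4) ≤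
      2 * ENNReal.ofReal δ + 2 * ENNReal.ofReal (2 * Real.exp (-(10 * R))) := by
    have e1 : ∀ m, 4⁻¹ ^ R * w (fun _ _ v => if 10 * v ≤ R then 1 else 0) m ≤
        2 * g f m + 2 * ENNReal.ofReal (2 * Real.exp (-(10 * R))) := by
      intro m
      have e2 : w (fun _ _ v => if 10 * v ≤ R then 1 else 0) m =
          w (fun m z v => if 10 * v ≤ R then hi m z else 0) m +
          w (fun m z v => if 10 * v ≤ R then lo m z else 0) m := by
        simp only [hw]
        rw [← wex_add]
        congr 1
        funext m z v
        split_ifs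
        · rw [hsum]
        · simp
      have e3 : ∀ F : List Bool → ℕ × ℕ × ℕ → ℝ≥0∞, (∀ m γ, F m γ ≤ f m γ + dev m γ) →
          g F m ≤ g f m + ENNReal.ofReal (2 * Real.exp (-(10 * R))) := fun F hF =>
        calc g F m ≤ g (fun m γ => f m γ + dev m γ) m := gex_mono κ _ l hF m _
          _ = g f m + g dev m := gex_add κ _ l f dev m _
          _ ≤ _ := by gcongr; exact h7 m
      rw [e2, mul_add]
      calc _ ≤ _ := add_le_add ((h2 m).trans (e3 _ h4)) ((h3 m).trans (e3 _ h5))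
        _ = _ := by ring
    have e4 := ex_mono μ e1
    rw [ex_const_mul, ex_add, ex_const, ex_const_mul] at e4
    calc _ ≤ _ := mul_le_mul_right h1 _
      _ ≤ _ := e4
      _ ≤ _ := by gcongr
  have h9 := exp_neg_lt (max δ 0) R hRpos (max_le hδ (Real.exp_pos _).le)
  have h10 : (4⁻¹ : ℝ≥0∞) ^ R * ENNReal.ofReal (3 / 4) =
      ENNReal.ofReal (4⁻¹ ^ R * (3 / 4)) := by
    rw [ENNReal.ofReal_mul (by positivity), ENNReal.ofReal_pow (by norm_num),
      ENNReal.ofReal_inv_of_pos (by norm_num), ENNReal.ofReal_ofNat]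
  have h11 : 2 * ENNReal.ofReal δ + 2 * ENNReal.ofReal (2 * Real.exp (-(10 * R))) =
      ENNReal.ofReal (2 * max δ 0 + 4 * Real.exp (-(10 * R))) := by
    have two : ∀ x, 2 * ENNReal.ofReal x = ENNReal.ofReal (2 * x) := fun x => by
      rw [ENNReal.ofReal_mul (by norm_num), ENNReal.ofReal_ofNat]
    have hδ' : ENNReal.ofReal δ = ENNReal.ofReal (max δ 0) := by
      rcases le_total δ 0 with h | h <;> simp [h]
    rw [hδ', two, two, ← ENNReal.ofReal_add (by positivity) (by positivity)]
    congr 1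
    ring
  rw [h10, h11] at h8
  rw [ENNReal.ofReal_le_ofReal_iff (by positivity)] at h8
  linarith

end CounterAlgorithm

/-! ### Assembling the entropy bound -/

namespace CounterAlgorithm

open RandomWalk

variable {k : ℕ} (A : CounterAlgorithm k)

theorem ex_leafSteps_le {K T n : ℕ} {C : ℝ≥0∞} (hK : 0 < K) (i : Fin k)
    (hn : k + k * (T * K ^ T) ≤ n) (hC : ∀ w : List (Fin k), w.length ≤ n → A.expectedBits w ≤ C)
    (t : List ℕ) (ht : ∀ q ∈ t, q < K) :
    ex (A.law (List.finRange k)) (fun m => ex (run (A.step K) (leafSteps K k T t) m)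
      fun y => (y.length : ℝ≥0∞)) ≤ C := by
  have h := A.ex_law_gex_le K 0 i (fun m _ => (m.length : ℝ≥0∞)) C (leafSteps K k T t)
    (List.finRange k) (0, 0, 0) (by simp) (by
      intro v γ hv _ _
      refine hC _ ?_
      obtain ⟨l, hl⟩ := leafSteps_prefix (k := k) K T t ht hK
      have h2 := sum_increments_schedule (k := k) K T
      rw [hl, List.map_append, List.sum_append] at h2
      simp
      omega)
  simpa only [gex_of_state] using h

theorem le_of_expectedBits_le {K T n : ℕ} {ε δ s : ℝ} (hA : A.IsApproximateCounter ε δ n)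
    (hk : 1 ≤ k) (hK : 1000 ≤ K) (hT : 1 ≤ T) (hn : k + k * (T * K ^ T) ≤ n) (hε : 0 ≤ ε)
    (hε' : ε * (1 + T * (K : ℝ) ^ T) ≤ 3 / 10 * (K : ℝ) ^ T)
    (hδ : δ ≤ Real.exp (-(10 * (K ^ (T - 1) : ℕ)))) (hs : 0 ≤ s)
    (hbits : ∀ w : List (Fin k), w.length ≤ n → A.expectedBits w ≤ ENNReal.ofReal s) :
    (T * k : ℝ) / 25600 ≤ Real.log 4 * s + Real.log 2 := by
  have hKpos : 0 < K := by omega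
  have hl4 : 0 ≤ Real.log 4 := Real.log_nonneg (by norm_num)
  have hl2 : 0 ≤ Real.log 2 := Real.log_nonneg (by norm_num)
  set κ := A.step K
  set μ := A.law (List.finRange k)
  -- This maximises the net gain per coin, `η / 2 * (1 / 40) - η ^ 2`; the maximum is `1 / 25600`.
  set η : ℝ := 1 / 160 with hη
  set C : ℝ := Real.log 4 * s + Real.log 2 + T * k * η ^ 2 with hCdef
  have h1 : ∀ t : List ℕ, (∀ q ∈ t, q < K) →
      ENNReal.ofReal (η / 2) * ex μ (pathLeaks K κ T t) ≤ ENNReal.ofReal C := by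
    intro t ht
    rw [← ex_const_mul]
    calc _ ≤ ex μ fun m => (ENNReal.ofReal (Real.log 4) *
          ex (run κ (leafSteps K k T t) m) (fun y => (y.length : ℝ≥0∞)) +
          ENNReal.ofReal (Real.log 2)) + (T * k : ℕ) * ENNReal.ofReal (η ^ 2) := by
          refine ex_mono μ fun m => ?_
          refine (pathLeaks_le K κ (by norm_num [hη]) (by norm_num [hη]) hKpos T t ht m).trans ?_
          gcongr
          exact ent_le_length _
      _ ≤ ENNReal.ofReal (Real.log 4) * ENNReal.ofReal s + ENNReal.ofReal (Real.log 2) +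
          (T * k : ℕ) * ENNReal.ofReal (η ^ 2) := by
          rw [ex_add, ex_add, ex_const, ex_const, ex_const_mul]
          gcongr
          exact A.ex_leafSteps_le hKpos ⟨0, hk⟩ hn hbits t ht
      _ = _ := by
          rw [← ENNReal.ofReal_mul hl4, ← ENNReal.ofReal_natCast, ← ENNReal.ofReal_mul (by positivity),
            ← ENNReal.ofReal_add (by positivity) hl2,
            ← ENNReal.ofReal_add (by positivity) (by positivity), hCdef]
          push_cast
          rfl
  have h2 : ENNReal.ofReal (η / 2) * ex μ (fun m => leafSum K T fun t => pathLeaks K κ T t m) ≤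
      K ^ T * ENNReal.ofReal C := by
    rw [← leafSum_ex, ← leafSum_const_mul]
    exact leafSum_le K T _ _ h1
  have h3 : ENNReal.ofReal (T * (k * ((K : ℝ) ^ T / 40))) ≤
      ex μ (fun m => leafSum K T fun t => pathLeaks K κ T t m) := by
    simp only [leafSum_pathLeaks, ex_sum, ex_const_mul]
    have h4 : ∀ a ∈ Finset.range T, ∀ i : Fin k, ENNReal.ofReal ((K ^ (T - 1 - a) : ℕ) / 40) ≤
        ex μ (windowLeaks κ (a + 1, i) (tailSteps K a i) (windows K a i (T - 1 - a))) := by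
      intro a ha i
      have haT : a + 1 + (T - 1 - a) = T := by have := Finset.mem_range.1 ha; omega
      refine (A.lt_ex_windowLeaks hA i hK ?_ hε ?_ ?_).le
      · rwa [haT]
      · rwa [haT]
      · refine hδ.trans (Real.exp_le_exp.2 ?_)
        have h5 : ((K ^ (T - 1 - a) : ℕ) : ℝ) ≤ (K ^ (T - 1) : ℕ) := by
          exact_mod_cast Nat.pow_le_pow_right hKpos (Nat.sub_le _ _)
        linarith
    calc _ = ∑ a ∈ Finset.range T, (K : ℝ≥0∞) ^ (a + 1) *
          ∑ i : Fin k, ENNReal.ofReal ((K ^ (T - 1 - a) : ℕ) / 40) := by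
          have h5 : ∀ a ∈ Finset.range T, (K : ℝ≥0∞) ^ (a + 1) *
              ∑ i : Fin k, ENNReal.ofReal ((K ^ (T - 1 - a) : ℕ) / 40) =
              ENNReal.ofReal (k * ((K : ℝ) ^ T / 40)) := by
            intro a ha
            have haT : a + 1 + (T - 1 - a) = T := by have := Finset.mem_range.1 ha; omega
            rw [Finset.sum_const, Finset.card_univ, Fintype.card_fin, nsmul_eq_mul,
              ← ENNReal.ofReal_natCast K, ← ENNReal.ofReal_pow (by positivity),
              ← ENNReal.ofReal_natCast k, ← ENNReal.ofReal_mul (by positivity),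
              ← ENNReal.ofReal_mul (by positivity)]
            congr 1
            have : (K : ℝ) ^ T = K ^ (a + 1) * K ^ (T - 1 - a) := by rw [← pow_add, haT]
            rw [this]
            push_cast
            ring
          rw [Finset.sum_congr rfl h5, Finset.sum_const, Finset.card_range, nsmul_eq_mul,
            ENNReal.ofReal_mul (by positivity), ENNReal.ofReal_natCast]
      _ ≤ _ := by
          refine Finset.sum_le_sum fun a ha => ?_
          gcongr with i
          exact h4 a ha i
  have h6 := (mul_le_mul_right h3 (ENNReal.ofReal (η / 2))).trans h2
  rw [← ENNReal.ofReal_mul (by norm_num [hη]), ← ENNReal.ofReal_natCast,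
    ← ENNReal.ofReal_pow (by positivity), ← ENNReal.ofReal_mul (by positivity),
    ENNReal.ofReal_le_ofReal_iff (by positivity)] at h6
  have hKT : (0 : ℝ) < (K : ℝ) ^ T := by positivity
  have h7 : (K : ℝ) ^ T * (η / 2 * (T * k / 40)) ≤ (K : ℝ) ^ T * C := by
    refine le_trans (le_of_eq ?_) h6
    ring
  have h8 := le_of_mul_le_mul_left h7 hKT
  rw [hCdef, hη] at h8
  linarith

end CounterAlgorithm

/-! ### Choice of constants -/

theorem mainTheorem3 :
    ∃ c₁ c₂ c₃ c₄ c : ℝ,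
      0 < c₁ ∧ c₁ < Real.exp (-1) ∧ 0 < c₂ ∧ 0 < c₃ ∧ 0 < c₄ ∧ 0 < c ∧
      ∀ (k n : ℕ) (ε δ : ℝ), 1 ≤ k → 0 < δ → δ < c₁ →
        0 < ε → ε < c₂ / Real.log (Real.log (1 / δ)) →
        (k : ℝ) * (c₃ * Real.log (1 / δ) ^ c₄) ≤ (n : ℝ) →
        (c * ((k : ℝ) * Real.log (Real.log (1 / δ))) ≤
            (k : ℝ) * min (Real.log ((n : ℝ) / (k : ℝ))) (Real.log (Real.log (1 / δ)))) ∧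
        ∀ A : CounterAlgorithm k, A.IsApproximateCounter ε δ n →
          ∃ w : List (Fin k), w.length ≤ n ∧
            ENNReal.ofReal (c * ((k : ℝ) * Real.log (Real.log (1 / δ)))) ≤ A.expectedBits w ∧
            ENNReal.ofReal (c * ((k : ℝ) *
              min (Real.log ((n : ℝ) / (k : ℝ))) (Real.log (Real.log (1 / δ))))) ≤
                A.expectedBits w := by
  -- The choice of `c₁` forces `T ≥ N`, so `T * k / 25600 ≥ 2` and half of it absorbs the additive
  -- `log 2`.
  obtain ⟨N, hN⟩ : ∃ N : ℕ, N = 51200 := ⟨_, rfl⟩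
  have hK1 : (1 : ℝ) < 1000 ^ N := one_lt_pow₀ (by norm_num) (by omega)
  refine ⟨Real.exp (-1000 ^ N), 1 / 10, 2, 2, 1 / 2000000, Real.exp_pos _,
    Real.exp_lt_exp.2 (by linarith), by norm_num, by norm_num, by norm_num, by norm_num, ?_⟩
  intro k n ε δ hk hδ0 hδ hε0 hε hn
  set L := Real.log (1 / δ) with hL
  have hδL : δ = Real.exp (-L) := by
    rw [hL, one_div, Real.log_inv, neg_neg, Real.exp_log hδ0]
  have hNL : (1000 : ℝ) ^ N < L := by
    rw [hδL, Real.exp_lt_exp] at hδ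
    linarith
  have hL1 : 1 < L := hK1.trans hNL
  have hlogL : 0 < Real.log L := Real.log_pos hL1
  have hkpos : (0 : ℝ) < k := by exact_mod_cast hk
  rw [Real.rpow_ofNat] at hn
  have hnk : L ≤ (n : ℝ) / k := by
    rw [le_div_iff₀ hkpos]
    nlinarith
  have hmin : min (Real.log ((n : ℝ) / k)) (Real.log L) = Real.log L :=
    min_eq_right (Real.log_le_log (by linarith) hnk)
  rw [hmin]
  refine ⟨by nlinarith [mul_pos hkpos hlogL], fun A hA => ?_⟩
  -- The greatest depth with `1000 ^ T ≤ log (1/δ)`. It satisfies `T ≤ log L ≤ 14 * T`, which gives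
  -- `ε * T ≤ 1/10` and stream length at most `2 * k * L ^ 2`.
  set T := Nat.log 1000 ⌊L⌋₊ with hT
  have hfl : ⌊L⌋₊ ≠ 0 := (Nat.floor_pos.2 hL1.le).ne'
  have hNT : N ≤ T := by
    refine Nat.le_log_of_pow_le (by norm_num) (Nat.le_floor ?_)
    push_cast
    exact hNL.le
  have hTL : (1000 : ℝ) ^ T ≤ L := by
    have h1 : 1000 ^ T ≤ ⌊L⌋₊ := Nat.pow_log_le_self 1000 hfl
    have h2 : ((1000 ^ T : ℕ) : ℝ) ≤ ⌊L⌋₊ := by exact_mod_cast h1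
    push_cast at h2
    exact h2.trans (Nat.floor_le (by linarith))
  have hLT : L < (1000 : ℝ) ^ (T + 1) := by
    have h1 : ⌊L⌋₊ < 1000 ^ (T + 1) := Nat.lt_pow_succ_log_self (by norm_num) _
    have h2 := (Nat.floor_lt (by linarith)).1 h1
    push_cast at h2
    exact h2
  have hT1 : (51200 : ℝ) ≤ T := by
    have : 51200 ≤ T := hN ▸ hNT
    exact_mod_cast this
  have hlog1 : Real.log 1000 ≤ 7 := by
    have h1 : Real.log 1000 ≤ Real.log (2 ^ 10) := Real.log_le_log (by norm_num) (by norm_num)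
    rw [Real.log_pow] at h1
    have := Real.log_two_lt_d9
    push_cast at h1
    linarith
  have hlog2 : 1 ≤ Real.log 1000 := by
    rw [Real.le_log_iff_exp_le (by norm_num)]
    have := Real.exp_one_lt_d9
    linarith
  have hlogT : Real.log L ≤ 14 * T := by
    have h1 := Real.log_le_log (by linarith) hLT.le
    rw [Real.log_pow] at h1
    push_cast at h1
    nlinarith
  have hTlog : (T : ℝ) ≤ Real.log L := by
    have h1 := Real.log_le_log (by positivity) hTL
    rw [Real.log_pow] at h1
    nlinarith
  have hTL' : (T : ℝ) ≤ L := hTlog.trans ((Real.log_le_sub_one_of_pos (by linarith)).trans (by linarith))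
  have hTK : (T : ℝ) * 1000 ^ T ≤ L ^ 2 := by
    rw [sq]
    gcongr
  have hKT : (1 : ℝ) ≤ 1000 ^ T := one_le_pow₀ (by norm_num)
  have key : ∃ w : List (Fin k), w.length ≤ n ∧
      ENNReal.ofReal (1 / 2000000 * (k * Real.log L)) ≤ A.expectedBits w := by
    by_contra! h
    have hb := A.le_of_expectedBits_le (K := 1000) (T := T) (s := 1 / 2000000 * (k * Real.log L))
      hA hk le_rfl (by omega) ?_ hε0.le ?_ ?_ (by positivity) fun w hw => (h w hw).le
    · have h4 : Real.log 4 ≤ 1.4 := by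
        have h1 : Real.log 4 = 2 * Real.log 2 := by
          rw [show (4 : ℝ) = 2 ^ 2 by norm_num, Real.log_pow]; norm_num
        have := Real.log_two_lt_d9
        linarith
      have h2 := Real.log_two_lt_d9
      have h5 : (k : ℝ) * Real.log L ≤ 14 * (T * k) := by nlinarith
      have h6 : (51200 : ℝ) ≤ T * k := by
        have : (1 : ℝ) ≤ k := by exact_mod_cast hk
        nlinarith
      have h7 : Real.log 4 * (1 / 2000000 * (k * Real.log L)) ≤
          1.4 * (1 / 2000000 * (14 * (T * k))) := by gcongr
      linarith
    · have h1 : ((k + k * (T * 1000 ^ T) : ℕ) : ℝ) ≤ n := by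
        push_cast
        refine le_trans ?_ hn
        have h2 : 1 + (T : ℝ) * 1000 ^ T ≤ 2 * L ^ 2 := by nlinarith
        calc (k : ℝ) + k * (T * 1000 ^ T) = k * (1 + T * 1000 ^ T) := by ring
          _ ≤ k * (2 * L ^ 2) := by gcongr
      exact_mod_cast h1
    · push_cast
      have h1 : ε * Real.log L < 1 / 10 := (lt_div_iff₀ hlogL).1 hε
      have h2 : ε * T ≤ 1 / 10 := by nlinarith
      have h3 : ε ≤ 1 / 10 := by nlinarith
      nlinarith
    · rw [hδL]
      gcongr
      push_cast
      refine le_trans ?_ hTL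
      obtain ⟨T', hT'⟩ : ∃ T', T = T' + 1 := ⟨T - 1, by omega⟩
      rw [hT', Nat.add_sub_cancel, pow_succ]
      have : (0 : ℝ) < 1000 ^ T' := by positivity
      linarith
  obtain ⟨w, hw, h⟩ := key
  exact ⟨w, hw, h, h⟩
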